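/- **Proposition 5.1.** There are a function $\varkappa_1(\delta)$ of $\delta\ge 0$, positive for $\delta>0$, with $\varkappa_1(\delta)\to 0$ as $\delta\to 0$, and, for every dimension $m$ and every $C>0$, a function $\varkappa_2(\delta,\mu\,|\,C,m)$ of $\delta,\mu\ge 0$, positive for $\delta,\mu>0$, with $\varkappa_2(\delta,\mu\,|\,C,m)\to 0$ as $\delta,\mu\to 0$ (in both limits the value $0$ of the arguments is allowed), such that the following holds. Let $(M,g)$ be a complete connected smooth Riemannian $m$-manifold with distance $d$, and let $\alpha:[0,a]\to M$, $\beta:[0,b]\to M$ be unit-speed $C^2$ curves with $\alpha(0)=\beta(0)=p$, $\alpha'(0)=\beta'(0)$ and geodesic curvatures $$|\nabla_{\alpha'}\alpha'|\le\delta_1,\qquad |\nabla_{\beta'}\beta'|\le\delta_2 .$$ Let $(U,(x^1,\dots,x^m))$ be a smooth chart of $M$ with $p\in U$, in which the metric and the Christoffel symbols satisfy $C^{-1}I\le (g_{ij})\le CI$ and $|\Gamma_{ij}^k|\le\mu$ for all $i,j,k$ everywhere on $U$. Put $r(s)=\min_{t\in[0,b]}d(\alpha(s),\beta(t))$. Let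 $0\le s\le\min(a,b)$, and suppose that for every $s_1\in[0,s]$ there is $t_1\in[0,b]$ with $t_1\le 2s$ such that $\beta([0,t_1])\subset U$, $d(\alpha(s_1),\beta(t_1))=r(s_1)$, and some minimal geodesic between $\alpha(s_1)$ and $\beta(t_1)$ lies in $U$. Then $$r(s)\le \varkappa_1(\delta_2)\,s^{5/4}+\varkappa_2(\delta_1,\mu\,|\,C,m)\,s^{3/2}.$$ -/

import Mathlib

open scoped Manifold ContDiff Topology BigOperators
open Set Filter Bundle

noncomputable section

namespace CurveDeviation

/-- The Euclidean space on which an `m`-dimensional manifold is modelled. -/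
abbrev Model (m : ℕ) : Type := EuclideanSpace ℝ (Fin m)

section Smooth

variable {m : ℕ} {M : Type*} [TopologicalSpace M] [ChartedSpace (Model m) M]

/-- The velocity `γ'(t)` of a curve `γ` defined on the time set `S` (one-sided at end points). -/
def velocity (γ : ℝ → M) (S : Set ℝ) (t : ℝ) : TangentSpace (𝓡 m) (γ t) :=
  mfderivWithin 𝓘(ℝ, ℝ) (𝓡 m) γ S t (1 : ℝ)

/-- The tangent vector `∑ i, v i • ∂/∂xⁱ` at the point of the chart `φ` with coordinates `y`. -/
def chartVector (φ : OpenPartialHomeomorph M (Model m)) (y v : Model m) :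
    TangentSpace (𝓡 m) (φ.symm y) :=
  mfderiv (𝓡 m) (𝓡 m) φ.symm y v

end Smooth

section Riemannian

variable {m : ℕ} {M : Type*} [MetricSpace M] [ChartedSpace (Model m) M]
  [RiemannianBundle (fun x : M => TangentSpace (𝓡 m) x)]

/-- The matrix `(g_ij)` of the metric in the chart `φ`, at the point with coordinates `y`. -/
def metricMatrix (φ : OpenPartialHomeomorph M (Model m)) (y : Model m) :
    Matrix (Fin m) (Fin m) ℝ :=
  Matrix.of fun i j =>
    inner ℝ (chartVector φ y (EuclideanSpace.single i 1))
      (chartVector φ y (EuclideanSpace.single j 1))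

/-- The partial derivative `∂_l g_ij` of a coefficient of the metric in the chart `φ`. -/
def metricDeriv (φ : OpenPartialHomeomorph M (Model m)) (l i j : Fin m) (y : Model m) : ℝ :=
  fderiv ℝ (fun z => metricMatrix φ z i j) y (EuclideanSpace.single l 1)

/-- The Christoffel symbol `Γ_ij^k` of the Levi-Civita connection in the chart `φ`:
`Γ_ij^k = (1/2) ∑_l g^{kl} (∂_i g_jl + ∂_j g_il - ∂_l g_ij)`. -/
def christoffel (φ : OpenPartialHomeomorph M (Model m)) (i j k : Fin m) (y : Model m) : ℝ :=
  (1 / 2 : ℝ) * ∑ l, (metricMatrix φ y)⁻¹ k l *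
    (metricDeriv φ i j l y + metricDeriv φ j i l y - metricDeriv φ l i j y)

/-- The components in the chart `φ` of the covariant acceleration `∇_{γ'} γ'` at time `t` of a
curve `γ` defined on the time set `S`: `(xᵏ)'' + ∑_ij Γ_ij^k (xⁱ)' (xʲ)'`. -/
def covAccelCoord (φ : OpenPartialHomeomorph M (Model m)) (γ : ℝ → M) (S : Set ℝ) (t : ℝ) :
    Model m :=
  WithLp.toLp 2 fun k =>
    derivWithin (derivWithin (fun τ => φ (γ τ)) S) S t k +
      ∑ i, ∑ j, christoffel φ i j k (φ (γ t)) *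
        derivWithin (fun τ => φ (γ τ)) S t i * derivWithin (fun τ => φ (γ τ)) S t j

/-- `|∇_{γ'} γ'| ≤ δ` on the time set `S`. The vector `∇_{γ'} γ'` does not depend on the smooth
chart in which it is computed; the bound is recorded in all of them. -/
def CovAccelLE (γ : ℝ → M) (S : Set ℝ) (δ : ℝ) : Prop :=
  ∀ t ∈ S, ∀ φ ∈ IsManifold.maximalAtlas (𝓡 m) ∞ M, γ t ∈ φ.source →
    ‖chartVector φ (φ (γ t)) (covAccelCoord φ γ S t)‖ ≤ δ

/-- A `C²` unit-speed curve `γ : [0, ℓ] → M` whose geodesic curvature is at most `δ`. -/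
structure IsUnitSpeedCurve (γ : ℝ → M) (ℓ δ : ℝ) : Prop where
  contMDiffOn : ContMDiffOn 𝓘(ℝ, ℝ) (𝓡 m) 2 γ (Icc 0 ℓ)
  unit_speed : ∀ t ∈ Icc 0 ℓ, ‖(velocity γ (Icc 0 ℓ) t : TangentSpace (𝓡 m) (γ t))‖ = 1
  curvature_le : CovAccelLE (m := m) γ (Icc 0 ℓ) δ

/-- `γ : [0, 1] → M` is a minimal geodesic from `x` to `y`: it solves `∇_{γ'} γ' = 0`, and its
(constant) speed, hence its length, is the distance of `x` and `y`. -/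
structure IsMinimalGeodesic (γ : ℝ → M) (x y : M) : Prop where
  contMDiffOn : ContMDiffOn 𝓘(ℝ, ℝ) (𝓡 m) 2 γ (Icc 0 1)
  source : γ 0 = x
  target : γ 1 = y
  geodesic : CovAccelLE (m := m) γ (Icc 0 1) 0
  minimal : ∀ t ∈ Icc (0 : ℝ) 1,
    ‖(velocity γ (Icc 0 1) t : TangentSpace (𝓡 m) (γ t))‖ = dist x y

/-- In the chart `φ`: `C⁻¹ I ≤ (g_ij) ≤ C I` and `|Γ_ij^k| ≤ μ`. -/
structure ChartBounds (φ : OpenPartialHomeomorph M (Model m)) (C μ : ℝ) : Prop where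
  lower : ∀ y ∈ φ.target,
    (metricMatrix φ y - C⁻¹ • (1 : Matrix (Fin m) (Fin m) ℝ)).PosSemidef
  upper : ∀ y ∈ φ.target,
    (C • (1 : Matrix (Fin m) (Fin m) ℝ) - metricMatrix φ y).PosSemidef
  christoffel_le : ∀ y ∈ φ.target, ∀ i j k, |christoffel φ i j k y| ≤ μ

/-- The distance `min_{t ∈ [0, ℓ]} d(x, β(t))` from `x` to the curve `β : [0, ℓ] → M`. -/
def distToCurve (β : ℝ → M) (ℓ : ℝ) (x : M) : ℝ :=
  Metric.infDist x (β '' Icc 0 ℓ)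

end Riemannian

end CurveDeviation

end

/-!
The proof reads both curves in the chart and differentiates the square of the distance
`r(s) = d(α(s), β)` through the energy of paths.

Write `κ` for a constant (depending on `m` and `C`) times `μ`. The Christoffel symbols determine the
derivatives of the metric (`ChartBounds.metricDeriv_eq`), so in the chart the metric varies at rate
`κ`, and at the scale `s` it may be replaced by its value `B` at the common starting point. If
`κ s` is not small, this fails, but then the trivial bound `r ≤ s` already gives the claim.
Let `e` be the common initial velocity. With respect to `B`, the velocities of the two curves differ
from `e` by `O((δᵢ + κ) s)`, where the coefficient of `δᵢ` is an absolute constant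
(`IsCoordCurve.velocity_sub_le`).

Fix `s₁`, and let `c` be the minimal geodesic from `α(s₁)` to a nearest point `β(t₁)`. Adding to `c`
an affine interpolation of the displacements of its end points gives competitors for the distance
at later times. Since the derivative of the displacement field along `c` is a constant vector, the
first order change of the energy is, up to `O(κ s²)`, a pairing under `B` of that vector with
`c(1) - c(0)` (`IsCoordSegment.eventually_energy_le`); the geodesic equation of `c` is not needed,
only its constant speed. If `t₁ < b`, both end points follow their curves, and the vector is
`β'(t₁) - α'(s₁)`, which is small. If `t₁ = b`, the end point on `β` rests and the vector is
`-α'(s₁)`, which is close to `-e`; but then `s₁ ≤ s ≤ b = t₁`, so `β(t₁)` has advanced at least as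
far in the direction `e` as `α(s₁)`, up to `O((δ₁ + δ₂ + κ) s²)`. In both cases the pairing is at
most `O((δ₁ + δ₂ + κ) s²)` (`endpoint_rate_le`), hence so is the right upper derivative of `r²`, and
`r(s)² ≤ (c₁ δ₂ + c₂ (δ₁ + κ)) s³` (`distToCurve_sq_le`), with an absolute constant `c₁`. Combining
the first term with `r ≤ s` turns the power `3/2` of `s` into `5/4` and leaves the fourth root of
`δ₂` (`le_rpow_add_rpow`).
-/

noncomputable section

namespace CurveDeviation

/-! ### Forms comparable to the norm -/

section BilinearForm

variable {E : Type*} [NormedAddCommGroup E] [NormedSpace ℝ E]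

/-- `B` is a symmetric bilinear form whose quadratic form lies between `R⁻² ‖v‖²` and
`R² ‖v‖²`. -/
structure IsInnerLike (R : ℝ) (B : E →L[ℝ] E →L[ℝ] ℝ) : Prop where
  symm : ∀ v w, B v w = B w v
  lower : ∀ v, ‖v‖ ^ 2 ≤ R ^ 2 * B v v
  upper : ∀ v, B v v ≤ R ^ 2 * ‖v‖ ^ 2

namespace IsInnerLike

variable {R : ℝ} {B B' : E →L[ℝ] E →L[ℝ] ℝ}

lemma nonneg (hB : IsInnerLike R B) (v : E) : 0 ≤ B v v := by
  by_contra! h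
  have h1 := hB.lower v
  have h2 : 0 ≤ ‖v‖ ^ 2 := by positivity
  have h3 : 0 ≤ R ^ 2 := by positivity
  have h4 : ‖v‖ ^ 2 = 0 := by nlinarith
  have h5 : v = 0 := by simpa using h4
  simp [h5] at h

/-- The Cauchy–Schwarz inequality, for upper bounds of the two norms. -/
lemma apply_le_mul (hB : IsInnerLike R B) {v w : E} {a b : ℝ} (ha : 0 ≤ a) (hb : 0 ≤ b)
    (hv : B v v ≤ a ^ 2) (hw : B w w ≤ b ^ 2) : B v w ≤ a * b := by
  have key : 0 ≤ B (b • v - a • w) (b • v - a • w) := hB.nonneg _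
  have h0 : ∀ x : E, B x x ≤ 0 → x = 0 := by
    intro x hx
    have h1 := hB.lower x
    have h3 : 0 ≤ R ^ 2 := by positivity
    have h4 : ‖x‖ ^ 2 = 0 := le_antisymm (by nlinarith) (by positivity)
    simpa using h4
  rcases ha.eq_or_lt with rfl | ha
  · have : v = 0 := h0 v (by simpa using hv)
    simp [this]
  rcases hb.eq_or_lt with rfl | hb
  · have : w = 0 := h0 w (by simpa using hw)
    simp [this]
  simp only [map_sub, map_smul, sub_apply, smul_apply,
    smul_eq_mul, hB.symm w v] at key
  have h1 : b ^ 2 * B v v ≤ b ^ 2 * a ^ 2 := by gcongr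
  have h2 : a ^ 2 * B w w ≤ a ^ 2 * b ^ 2 := by gcongr
  have h3 : 2 * (a * b) * B v w ≤ 2 * (a * b) * (a * b) := by nlinarith
  exact le_of_mul_le_mul_left h3 (by positivity)

lemma abs_apply_le_mul (hB : IsInnerLike R B) {v w : E} {a b : ℝ} (ha : 0 ≤ a) (hb : 0 ≤ b)
    (hv : B v v ≤ a ^ 2) (hw : B w w ≤ b ^ 2) : |B v w| ≤ a * b := by
  rw [abs_le']
  refine ⟨hB.apply_le_mul ha hb hv hw, ?_⟩
  have := hB.apply_le_mul (v := -v) (w := w) ha hb (by simpa using hv) hw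
  simpa using this

lemma add_apply_self_le (hB : IsInnerLike R B) {v w : E} {a b : ℝ} (ha : 0 ≤ a) (hb : 0 ≤ b)
    (hv : B v v ≤ a ^ 2) (hw : B w w ≤ b ^ 2) : B (v + w) (v + w) ≤ (a + b) ^ 2 := by
  have := hB.apply_le_mul ha hb hv hw
  simp only [map_add, add_apply, hB.symm w v]
  nlinarith

lemma sub_apply_self_le (hB : IsInnerLike R B) {v w : E} {a b : ℝ} (ha : 0 ≤ a) (hb : 0 ≤ b)
    (hv : B v v ≤ a ^ 2) (hw : B w w ≤ b ^ 2) : B (v - w) (v - w) ≤ (a + b) ^ 2 := by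
  rw [sub_eq_add_neg]
  exact hB.add_apply_self_le ha hb hv (by simpa using hw)

lemma norm_le (hB : IsInnerLike R B) (hR : 0 ≤ R) {v : E} {a : ℝ} (ha : 0 ≤ a)
    (hv : B v v ≤ a ^ 2) : ‖v‖ ≤ R * a := by
  refine le_of_sq_le_sq ?_ (by positivity)
  nlinarith [hB.lower v, mul_le_mul_of_nonneg_left hv (sq_nonneg R)]

/-- Two forms that differ by at most `η` have comparable quadratic forms. -/
lemma apply_self_le (hB : IsInnerLike R B) {η : ℝ} (hη : 0 ≤ η) 
    (h : ∀ v w, |B' v w - B v w| ≤ η * ‖v‖ * ‖w‖) (v : E) :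
    B' v v ≤ (1 + η * R ^ 2) * B v v := by
  have h1 := (le_abs_self _).trans (h v v)
  nlinarith [mul_le_mul_of_nonneg_left (hB.lower v) hη]

/-- The mean value inequality for the norm of `B`. -/
lemma image_sub_le (hB : IsInnerLike R B) {z z' : ℝ → E} {k T t : ℝ} (hk : 0 ≤ k)
    (hz : ∀ τ ∈ Icc 0 T, HasDerivWithinAt z (z' τ) (Icc 0 T) τ)
    (hz' : ∀ τ ∈ Icc 0 T, B (z' τ) (z' τ) ≤ k ^ 2) (ht : t ∈ Icc 0 T) :
    B (z t - z 0) (z t - z 0) ≤ (k * t) ^ 2 := by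
  -- pair the increment with itself, which makes the inequality a real-valued one
  set w := z t - z 0 with hw
  set N := Real.sqrt (B w w) with hN
  have hN2 : N ^ 2 = B w w := Real.sq_sqrt (hB.nonneg w)
  have hN0 : 0 ≤ N := Real.sqrt_nonneg _
  have hsub : Icc 0 t ⊆ Icc 0 T := Icc_subset_Icc_right ht.2
  have hd : ∀ τ ∈ Icc 0 t, HasDerivWithinAt (fun τ => B w (z τ)) (B w (z' τ)) (Icc 0 t) τ :=
    fun τ hτ => (B w).hasFDerivAt.comp_hasDerivWithinAt τ ((hz τ (hsub hτ)).mono hsub)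
  have := norm_image_sub_le_of_norm_deriv_le_segment' hd (C := N * k)
    (fun τ hτ => hB.abs_apply_le_mul hN0 hk hN2.ge (hz' τ (hsub (Ico_subset_Icc_self hτ))))
    t (right_mem_Icc.2 ht.1)
  rw [← map_sub, ← hw, ← hN2] at this
  have h1 : N * N ≤ N * (k * t) := by
    have := (le_abs_self _).trans this
    nlinarith
  rw [← hN2]
  rcases hN0.eq_or_lt with h | h
  · rw [← h, zero_pow two_ne_zero]; positivity
  · have := le_of_mul_le_mul_left h1 h
    gcongr

end IsInnerLike

end BilinearForm

/-! ### Almost flat metrics and curves in them -/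

section AlmostFlat

variable {E : Type*} [NormedAddCommGroup E] [NormedSpace ℝ E]

/-- A metric `G` on an open set `Ω` of a vector space which is comparable to the norm, with
constant `R`, and whose coefficients have derivative at most `κ`. -/
structure AlmostFlat (Ω : Set E) (G : E → E →L[ℝ] E →L[ℝ] ℝ) (R κ : ℝ) : Prop where
  isOpen : IsOpen Ω
  one_le : 1 ≤ R
  nonneg : 0 ≤ κ
  isInnerLike : ∀ y ∈ Ω, IsInnerLike R (G y)
  continuousOn : ContinuousOn (fun p : E × E × E => G p.1 p.2.1 p.2.2) (Ω ×ˢ univ)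
  differentiableAt : ∀ y ∈ Ω, ∀ v w, DifferentiableAt ℝ (fun y => G y v w) y
  norm_fderiv_le : ∀ y ∈ Ω, ∀ v w, ‖fderiv ℝ (fun y => G y v w) y‖ ≤ κ * ‖v‖ * ‖w‖

variable {Ω : Set E} {G : E → E →L[ℝ] E →L[ℝ] ℝ} {R κ : ℝ}

lemma AlmostFlat.abs_sub_le_of_curve (hG : AlmostFlat Ω G R κ) {x x' : ℝ → E} {L T t : ℝ}
    (hx : ∀ τ ∈ Icc 0 T, HasDerivWithinAt x (x' τ) (Icc 0 T) τ)
    (hL : ∀ τ ∈ Icc 0 T, ‖x' τ‖ ≤ L) (hΩ : ∀ τ ∈ Icc 0 T, x τ ∈ Ω) (ht : t ∈ Icc 0 T) (v w : E) :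
    |G (x t) v w - G (x 0) v w| ≤ κ * L * t * ‖v‖ * ‖w‖ := by
  have hd : ∀ τ ∈ Icc 0 T, HasDerivWithinAt (fun τ => G (x τ) v w)
      (fderiv ℝ (fun y => G y v w) (x τ) (x' τ)) (Icc 0 T) τ := fun τ hτ =>
    (hG.differentiableAt _ (hΩ τ hτ) v w).hasFDerivAt.comp_hasDerivWithinAt τ (hx τ hτ)
  have hκ := hG.nonneg
  have := norm_image_sub_le_of_norm_deriv_le_segment' hd (C := κ * ‖v‖ * ‖w‖ * L) (fun τ hτ => by
    have hτ' := Ico_subset_Icc_self hτ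
    refine (ContinuousLinearMap.le_opNorm _ _).trans ?_
    exact mul_le_mul (hG.norm_fderiv_le _ (hΩ τ hτ') v w) (hL τ hτ') (norm_nonneg _)
      (by positivity)) t ht
  rw [Real.norm_eq_abs] at this
  linarith

lemma AlmostFlat.abs_sub_le_of_ball (hG : AlmostFlat Ω G R κ) {y V : E} {ε : ℝ}
    (hy : Metric.ball y ε ⊆ Ω) (hV : ‖V‖ < ε) (v w : E) :
    |G (y + V) v w - G y v w| ≤ κ * ‖V‖ * ‖v‖ * ‖w‖ := by
  have := (convex_ball y ε).norm_image_sub_le_of_norm_fderiv_le (𝕜 := ℝ)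
    (f := fun y => G y v w) (C := κ * ‖v‖ * ‖w‖)
    (fun z hz => hG.differentiableAt z (hy hz) v w)
    (fun z hz => hG.norm_fderiv_le z (hy hz) v w)
    (x := y) (y := y + V) (Metric.mem_ball_self ((norm_nonneg V).trans_lt hV)) (by simpa using hV)
  rw [Real.norm_eq_abs, add_sub_cancel_left] at this
  linarith

/-- A unit-speed curve `x` in `Ω`, on the time interval `[0, T]`, with velocity `x'`, acceleration
`x''` and, up to an error `κ` in the norm of `E`, geodesic curvature at most `δ`. -/
structure IsCoordCurve (Ω : Set E) (G : E → E →L[ℝ] E →L[ℝ] ℝ) (κ δ T : ℝ)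
    (x x' x'' : ℝ → E) : Prop where
  mem : ∀ t ∈ Icc 0 T, x t ∈ Ω
  hasDeriv : ∀ t ∈ Icc 0 T, HasDerivWithinAt x (x' t) (Icc 0 T) t
  hasDeriv' : ∀ t ∈ Icc 0 T, HasDerivWithinAt x' (x'' t) (Icc 0 T) t
  unit_speed : ∀ t ∈ Icc 0 T, G (x t) (x' t) (x' t) = 1
  curvature : ∀ t ∈ Icc 0 T, ∃ z, G (x t) z z ≤ δ ^ 2 ∧ ‖x'' t - z‖ ≤ κ

namespace IsCoordCurve

variable {δ T : ℝ} {x x' x'' : ℝ → E}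

lemma norm_velocity_le (hx : IsCoordCurve Ω G κ δ T x x' x'') (hG : AlmostFlat Ω G R κ) {t : ℝ}
    (ht : t ∈ Icc 0 T) : ‖x' t‖ ≤ R := by
  simpa using (hG.isInnerLike _ (hx.mem t ht)).norm_le (zero_le_one.trans hG.one_le) zero_le_one
    (by simpa using (hx.unit_speed t ht).le)

lemma abs_metric_sub_le (hx : IsCoordCurve Ω G κ δ T x x' x'') (hG : AlmostFlat Ω G R κ) {t : ℝ}
    (ht : t ∈ Icc 0 T) (v w : E) :
    |G (x t) v w - G (x 0) v w| ≤ κ * R * t * ‖v‖ * ‖w‖ :=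
  hG.abs_sub_le_of_curve hx.hasDeriv (fun _ hτ => hx.norm_velocity_le hG hτ) hx.mem ht v w

/-- Measured at the starting point, the velocity turns at rate `O(δ + κ)`. -/
lemma velocity_sub_le (hx : IsCoordCurve Ω G κ δ T x x' x'') (hG : AlmostFlat Ω G R κ)
    (hδ : 0 ≤ δ) (hT : κ * R * T * R ^ 2 ≤ 1) {t : ℝ} (ht : t ∈ Icc 0 T) :
    G (x 0) (x' t - x' 0) (x' t - x' 0) ≤ ((2 * δ + R * κ) * t) ^ 2 := by
  have hR := zero_le_one.trans hG.one_le
  have hκ := hG.nonneg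
  have h0 : (0 : ℝ) ∈ Icc 0 T := left_mem_Icc.2 (ht.1.trans ht.2)
  have hB := hG.isInnerLike _ (hx.mem 0 h0)
  refine hB.image_sub_le (by positivity) hx.hasDeriv' (fun τ hτ => ?_) ht
  obtain ⟨z, hz, hz'⟩ := hx.curvature τ hτ
  have h1 : G (x 0) z z ≤ (2 * δ) ^ 2 := by
    have h2 := (hG.isInnerLike _ (hx.mem τ hτ)).apply_self_le (η := κ * R * T) (B' := G (x 0))
      (by have := ht.1.trans ht.2; positivity)
      (fun v w => by
        rw [abs_sub_comm]
        exact (hx.abs_metric_sub_le hG hτ v w).trans (by have := hτ.2; gcongr)) z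
    nlinarith [(hG.isInnerLike _ (hx.mem τ hτ)).nonneg z]
  have h2 : G (x 0) (x'' τ - z) (x'' τ - z) ≤ (R * κ) ^ 2 := by
    refine (hB.upper _).trans ?_
    rw [mul_pow]
    gcongr
  have := hB.add_apply_self_le (by positivity) (by positivity) h1 h2
  simpa using this

lemma position_sub_le (hx : IsCoordCurve Ω G κ δ T x x' x'') (hG : AlmostFlat Ω G R κ)
    (hδ : 0 ≤ δ) (hT : κ * R * T * R ^ 2 ≤ 1) {t : ℝ} (ht : t ∈ Icc 0 T) :
    G (x 0) (x t - x 0 - t • x' 0) (x t - x 0 - t • x' 0) ≤ ((2 * δ + R * κ) * T * t) ^ 2 := by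
  have hR := zero_le_one.trans hG.one_le
  have hκ := hG.nonneg
  have h0 : (0 : ℝ) ∈ Icc 0 T := left_mem_Icc.2 (ht.1.trans ht.2)
  have hT0 := ht.1.trans ht.2
  have hB := hG.isInnerLike _ (hx.mem 0 h0)
  have := hB.image_sub_le (z := fun τ => x τ - τ • x' 0) (z' := fun τ => x' τ - x' 0) (T := T)
    (k := (2 * δ + R * κ) * T) (by positivity) (fun τ hτ => by
      simpa using (hx.hasDeriv τ hτ).fun_sub
        ((hasDerivWithinAt_id τ (Icc 0 T)).smul_const (x' 0))) (fun τ hτ => by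
      refine (hx.velocity_sub_le hG hδ hT hτ).trans ?_
      have := hτ.1
      have := hτ.2
      gcongr) ht
  simp only [zero_smul, sub_zero] at this
  rwa [sub_right_comm] at this

end IsCoordCurve

end AlmostFlat

/-! ### The first variation of the energy -/

lemma hasDerivWithinAt_shift {E : Type*} [NormedAddCommGroup E] [NormedSpace ℝ E] {x : ℝ → E}
    {x' : E} {ℓ t : ℝ} (hx : HasDerivWithinAt x x' (Icc 0 ℓ) t) (ht : 0 ≤ t) (htℓ : t < ℓ) :
    HasDerivWithinAt (fun h => x (t + h) - x t) x' (Ici 0) 0 := by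
  have h1 : HasDerivWithinAt x x' (Ici t) t :=
    hx.mono_of_mem_nhdsWithin (mem_of_superset (Icc_mem_nhdsGE htℓ) (Icc_subset_Icc_left ht))
  have h2 : HasDerivWithinAt (fun h : ℝ => t + h) 1 (Ici 0) 0 :=
    (hasDerivWithinAt_id (0 : ℝ) (Ici 0)).const_add t
  have h3 := (HasDerivWithinAt.scomp_of_eq (0 : ℝ) h1 h2
    (fun h hh => mem_Ici.2 (le_add_of_nonneg_right hh)) (by simp)).sub_const (x t)
  simpa using h3

section FirstVariation

variable {E : Type*} [NormedAddCommGroup E] [NormedSpace ℝ E]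
  {Ω : Set E} {G : E → E →L[ℝ] E →L[ℝ] ℝ} {R κ : ℝ}

/-- A `C¹` path `c` in `Ω`, on the time interval `[0, 1]`, with velocity `c'` and constant
speed `r`. -/
structure IsCoordSegment (Ω : Set E) (G : E → E →L[ℝ] E →L[ℝ] ℝ) (r : ℝ) (c c' : ℝ → E) :
    Prop where
  mem : ∀ t ∈ Icc (0 : ℝ) 1, c t ∈ Ω
  hasDeriv : ∀ t ∈ Icc (0 : ℝ) 1, HasDerivWithinAt c (c' t) (Icc 0 1) t
  continuousOn : ContinuousOn c' (Icc 0 1)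
  speed : ∀ t ∈ Icc (0 : ℝ) 1, G (c t) (c' t) (c' t) = r ^ 2

lemma IsCoordSegment.norm_velocity_le {c c' : ℝ → E} {r : ℝ} (hc : IsCoordSegment Ω G r c c')
    (hG : AlmostFlat Ω G R κ) (hr : 0 ≤ r) {t : ℝ} (ht : t ∈ Icc (0 : ℝ) 1) : ‖c' t‖ ≤ R * r :=
  (hG.isInnerLike _ (hc.mem t ht)).norm_le (zero_le_one.trans hG.one_le) hr (hc.speed t ht).le

lemma AlmostFlat.continuousOn_apply (hG : AlmostFlat Ω G R κ) {c a b : ℝ → E} {S : Set ℝ}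
    (hc : ContinuousOn c S) (hΩ : ∀ t ∈ S, c t ∈ Ω) (ha : ContinuousOn a S)
    (hb : ContinuousOn b S) : ContinuousOn (fun t => G (c t) (a t) (b t)) S :=
  hG.continuousOn.comp (hc.prodMk (ha.prodMk hb)) fun t ht => ⟨hΩ t ht, mem_univ _⟩

/-- If the metric is `η`-close to a constant form `B` along `c`, then the pairing of the velocity
of `c` with a constant field depends, up to an error, on the end points of `c` only. -/
lemma IsCoordSegment.integral_apply_le {c c' : ℝ → E} {r η : ℝ} {B : E →L[ℝ] E →L[ℝ] ℝ}
    (hc : IsCoordSegment Ω G r c c') (hG : AlmostFlat Ω G R κ) (hr : 0 ≤ r) (hη : 0 ≤ η)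
    (hB : ∀ t ∈ Icc (0 : ℝ) 1, ∀ v w, |G (c t) v w - B v w| ≤ η * ‖v‖ * ‖w‖) (w : E) :
    ∫ t in (0 : ℝ)..1, G (c t) (c' t) w ≤ B (c 1 - c 0) w + η * (R * r) * ‖w‖ := by
  have hcc : ContinuousOn c (Icc 0 1) := fun t ht => (hc.hasDeriv t ht).continuousWithinAt
  have h1 : ContinuousOn (fun t => G (c t) (c' t) w) (Icc 0 1) :=
    hG.continuousOn_apply hcc hc.mem hc.continuousOn continuousOn_const
  have h2 : ContinuousOn (fun t => B (c' t) w) (Icc 0 1) := by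
    have := (B.flip w).continuous.comp_continuousOn hc.continuousOn
    exact this
  have h3 : ∫ t in (0 : ℝ)..1, B (c' t) w = B (c 1 - c 0) w := by
    rw [intervalIntegral.integral_eq_sub_of_hasDerivAt_of_le zero_le_one
      (f := fun t => B.flip w (c t))]
    · simp
    · exact (B.flip w).continuous.comp_continuousOn hcc
    · intro t ht
      exact (B.flip w).hasFDerivAt.comp_hasDerivAt t
        ((hc.hasDeriv t (Ioo_subset_Icc_self ht)).hasDerivAt (Icc_mem_nhds ht.1 ht.2))
    · exact h2.intervalIntegrable_of_Icc zero_le_one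
  calc ∫ t in (0 : ℝ)..1, G (c t) (c' t) w
      ≤ ∫ t in (0 : ℝ)..1, (B (c' t) w + η * (R * r) * ‖w‖) := by
        refine intervalIntegral.integral_mono_on zero_le_one
          (h1.intervalIntegrable_of_Icc zero_le_one)
          ((h2.add continuousOn_const).intervalIntegrable_of_Icc zero_le_one) fun t ht => ?_
        have h4 := (le_abs_self _).trans (hB t ht (c' t) w)
        have h5 : η * ‖c' t‖ * ‖w‖ ≤ η * (R * r) * ‖w‖ := by
          gcongr
          exact hc.norm_velocity_le hG hr ht
        linarith
    _ = _ := by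
        rw [intervalIntegral.integral_add (h2.intervalIntegrable_of_Icc zero_le_one) (by simp), h3]
        simp

/-- If the end points of `c` move by `p` and `q`, then so does the path, with the
interpolated displacement `p + t • (q - p)`; this is its energy to second order in the size of
the displacement. -/
lemma IsCoordSegment.energy_le {c c' : ℝ → E} {r η ε L : ℝ} {B : E →L[ℝ] E →L[ℝ] ℝ} {p q : E}
    (hc : IsCoordSegment Ω G r c c') (hG : AlmostFlat Ω G R κ) (hr : 0 ≤ r) (hη : 0 ≤ η)
    (hB : ∀ t ∈ Icc (0 : ℝ) 1, ∀ v w, |G (c t) v w - B v w| ≤ η * ‖v‖ * ‖w‖)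
    (hε : ∀ t ∈ Icc (0 : ℝ) 1, Metric.ball (c t) ε ⊆ Ω) (hL : L < ε) (hp : ‖p‖ ≤ L)
    (hq : ‖q‖ ≤ L) :
    (∀ t ∈ Icc (0 : ℝ) 1, c t + (p + t • (q - p)) ∈ Ω) ∧
    ∫ t in (0 : ℝ)..1, G (c t + (p + t • (q - p))) (c' t + (q - p)) (c' t + (q - p)) ≤
      (1 + κ * L * R ^ 2) *
        (r ^ 2 + 2 * B (c 1 - c 0) (q - p) + 4 * η * (R * r) * L + 4 * R ^ 2 * L ^ 2) := by
  have hκ := hG.nonneg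
  have hR := zero_le_one.trans hG.one_le
  have hL0 : 0 ≤ L := (norm_nonneg _).trans hp
  have hV : ∀ t ∈ Icc (0 : ℝ) 1, ‖p + t • (q - p)‖ ≤ L := by
    intro t ht
    have h1 : p + t • (q - p) = (1 - t) • p + t • q := by module
    rw [h1]
    refine (norm_add_le _ _).trans ?_
    rw [norm_smul, norm_smul, Real.norm_of_nonneg ht.1, Real.norm_of_nonneg (sub_nonneg.2 ht.2)]
    have h2 := mul_le_mul_of_nonneg_left hp (sub_nonneg.2 ht.2)
    have h3 := mul_le_mul_of_nonneg_left hq ht.1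
    linarith
  have hmem : ∀ t ∈ Icc (0 : ℝ) 1, c t + (p + t • (q - p)) ∈ Ω := fun t ht =>
    hε t ht (by simpa using (hV t ht).trans_lt hL)
  refine ⟨hmem, ?_⟩
  set w := q - p with hw
  have hwL : ‖w‖ ≤ 2 * L := (norm_sub_le _ _).trans (by linarith)
  have hcc : ContinuousOn c (Icc 0 1) := fun t ht => (hc.hasDeriv t ht).continuousWithinAt
  have hcw : ContinuousOn (fun t => c' t + w) (Icc 0 1) := hc.continuousOn.add continuousOn_const
  have h1 : ContinuousOn (fun t => G (c t) (c' t) w) (Icc 0 1) :=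
    hG.continuousOn_apply hcc hc.mem hc.continuousOn continuousOn_const
  have h2 : ContinuousOn (fun t => G (c t + (p + t • w)) (c' t + w) (c' t + w)) (Icc 0 1) :=
    hG.continuousOn_apply (hcc.add (by fun_prop)) hmem hcw hcw
  have h3 : ContinuousOn (fun t => r ^ 2 + 2 * G (c t) (c' t) w + R ^ 2 * (2 * L) ^ 2)
      (Icc 0 1) := (continuousOn_const.add (continuousOn_const.mul h1)).add continuousOn_const
  have hI : ∫ t in (0 : ℝ)..1, (r ^ 2 + 2 * G (c t) (c' t) w + R ^ 2 * (2 * L) ^ 2) =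
      r ^ 2 + 2 * (∫ t in (0 : ℝ)..1, G (c t) (c' t) w) + R ^ 2 * (2 * L) ^ 2 := by
    have h4 := h1.intervalIntegrable_of_Icc (μ := MeasureTheory.volume) zero_le_one
    rw [intervalIntegral.integral_add ((by simp : IntervalIntegrable (fun _ => r ^ 2) _ _ _).add
      (h4.const_mul 2)) (by simp), intervalIntegral.integral_add (by simp) (h4.const_mul 2),
      intervalIntegral.integral_const_mul]
    simp
  have hJ := hc.integral_apply_le hG hr hη hB w
  have hJ' : η * (R * r) * ‖w‖ ≤ η * (R * r) * (2 * L) := by gcongr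
  calc ∫ t in (0 : ℝ)..1, G (c t + (p + t • w)) (c' t + w) (c' t + w)
      ≤ ∫ t in (0 : ℝ)..1, (1 + κ * L * R ^ 2) *
          (r ^ 2 + 2 * G (c t) (c' t) w + R ^ 2 * (2 * L) ^ 2) := by
        refine intervalIntegral.integral_mono_on zero_le_one
          (h2.intervalIntegrable_of_Icc zero_le_one)
          ((continuousOn_const.mul h3).intervalIntegrable_of_Icc zero_le_one) fun t ht => ?_
        have hI := hG.isInnerLike _ (hc.mem t ht)
        refine (hI.apply_self_le (η := κ * L) (by positivity) (fun v w' => ?_) _).trans ?_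
        · refine (hG.abs_sub_le_of_ball (hε t ht) ((hV t ht).trans_lt hL) v w').trans ?_
          have := hV t ht
          gcongr
        · refine mul_le_mul_of_nonneg_left ?_ (by positivity)
          have h5 := hI.upper w
          have h6 : R ^ 2 * ‖w‖ ^ 2 ≤ R ^ 2 * (2 * L) ^ 2 := by gcongr
          simp only [map_add, add_apply, hI.symm w (c' t), hc.speed t ht]
          linarith
    _ = (1 + κ * L * R ^ 2) *
        (r ^ 2 + 2 * (∫ t in (0 : ℝ)..1, G (c t) (c' t) w) + R ^ 2 * (2 * L) ^ 2) := by
        rw [intervalIntegral.integral_const_mul, hI]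
    _ ≤ _ := by
        refine mul_le_mul_of_nonneg_left ?_ (by positivity)
        linarith

/-- The first variation of the energy of `c`, as an upper bound, when its end points move along
curves with velocities `p'` and `q'`. -/
lemma IsCoordSegment.eventually_energy_le {c c' : ℝ → E} {r η K : ℝ} {B : E →L[ℝ] E →L[ℝ] ℝ}
    {p q : ℝ → E} {p' q' : E}
    (hc : IsCoordSegment Ω G r c c') (hG : AlmostFlat Ω G R κ) (hr : 0 ≤ r) (hη : 0 ≤ η)
    (hB : ∀ t ∈ Icc (0 : ℝ) 1, ∀ v w, |G (c t) v w - B v w| ≤ η * ‖v‖ * ‖w‖)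
    (hp : HasDerivWithinAt p p' (Ici 0) 0) (hp0 : p 0 = 0) (hp' : ‖p'‖ ≤ R)
    (hq : HasDerivWithinAt q q' (Ici 0) 0) (hq0 : q 0 = 0) (hq' : ‖q'‖ ≤ R)
    (hK : κ * (R + 1) * R ^ 2 * r ^ 2 + 2 * B (c 1 - c 0) (q' - p') +
      4 * η * (R * r) * (R + 1) < K) :
    ∀ᶠ h in 𝓝[>] (0 : ℝ),
      (∀ t ∈ Icc (0 : ℝ) 1, c t + (p h + t • (q h - p h)) ∈ Ω) ∧
      ∫ t in (0 : ℝ)..1,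
        G (c t + (p h + t • (q h - p h))) (c' t + (q h - p h)) (c' t + (q h - p h)) ≤
          r ^ 2 + K * h := by
  have hcc : ContinuousOn c (Icc 0 1) := fun t ht => (hc.hasDeriv t ht).continuousWithinAt
  obtain ⟨ε, hε, hεΩ⟩ : ∃ ε > 0, ∀ t ∈ Icc (0 : ℝ) 1, Metric.ball (c t) ε ⊆ Ω := by
    obtain ⟨ε, hε, h⟩ := (isCompact_Icc.image_of_continuousOn hcc).exists_thickening_subset_open
      hG.isOpen (image_subset_iff.2 hc.mem)
    exact ⟨ε, hε, fun t ht =>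
      (Metric.ball_subset_thickening (mem_image_of_mem c ht) ε).trans h⟩
  have hR := zero_le_one.trans hG.one_le
  have small : ∀ {f : ℝ → E} {f' : E}, HasDerivWithinAt f f' (Ici 0) 0 → f 0 = 0 → ‖f'‖ ≤ R →
      ∀ᶠ h in 𝓝[>] (0 : ℝ), ‖f h‖ ≤ (R + 1) * h := by
    intro f f' hf hf0 hf'
    filter_upwards [hf.Ioi_of_Ici.limsup_norm_slope_le (r := R + 1) (by linarith),
      self_mem_nhdsWithin] with h h1 h2
    have h2' : (0 : ℝ) < h := h2
    rw [hf0, sub_zero, sub_zero, Real.norm_of_nonneg h2'.le, inv_mul_lt_iff₀ h2'] at h1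
    linarith
  -- the bound of `energy_le`, as a function of the time step
  set F : ℝ → ℝ := fun h => (1 + κ * ((R + 1) * h) * R ^ 2) *
    (r ^ 2 + 2 * B (c 1 - c 0) (q h - p h) + 4 * η * (R * r) * ((R + 1) * h) +
      4 * R ^ 2 * ((R + 1) * h) ^ 2) with hF
  have hid : HasDerivWithinAt (fun h : ℝ => h) 1 (Ici 0) 0 := hasDerivWithinAt_id _ _
  have hFd : HasDerivWithinAt F (κ * (R + 1) * R ^ 2 * r ^ 2 + 2 * B (c 1 - c 0) (q' - p') +
      4 * η * (R * r) * (R + 1)) (Ici 0) 0 := by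
    have h1 := (((hid.const_mul (R + 1)).const_mul κ).mul_const (R ^ 2)).const_add 1
    have h2 : HasDerivWithinAt (fun h => B (c 1 - c 0) (q h - p h)) (B (c 1 - c 0) (q' - p'))
      (Ici 0) 0 := (B (c 1 - c 0)).hasFDerivAt.comp_hasDerivWithinAt (0 : ℝ) (hq.fun_sub hp)
    have h3 := (((h2.const_mul 2).const_add (r ^ 2)).fun_add
      ((hid.const_mul (R + 1)).const_mul (4 * η * (R * r)))).fun_add
      (((hid.const_mul (R + 1)).fun_pow 2).const_mul (4 * R ^ 2))
    refine (h1.fun_mul h3).congr_deriv ?_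
    simp [hp0, hq0]
    ring
  have hF0 : F 0 = r ^ 2 := by simp [hF, hp0, hq0]
  have hsm : ∀ᶠ h in 𝓝[>] (0 : ℝ), (R + 1) * h < ε := by
    have : Tendsto (fun h : ℝ => (R + 1) * h) (𝓝[>] 0) (𝓝 ((R + 1) * 0)) :=
      (tendsto_id.const_mul _).mono_left nhdsWithin_le_nhds
    rw [mul_zero] at this
    exact this.eventually_lt_const hε
  filter_upwards [small hp hp0 hp', small hq hq0 hq', hsm, self_mem_nhdsWithin,
    hFd.Ioi_of_Ici.limsup_slope_le' (by simp) hK] with h h1 h2 h3 h4 h5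
  have h4' : (0 : ℝ) < h := h4
  obtain ⟨h6, h7⟩ := hc.energy_le hG hr hη hB hεΩ h3 h1 h2
  refine ⟨h6, h7.trans ?_⟩
  rw [slope_def_field, sub_zero, hF0, div_lt_iff₀ h4'] at h5
  linarith

end FirstVariation

/-! ### The rate of change of the squared distance -/

section Rate

variable {E : Type*} [NormedAddCommGroup E] [NormedSpace ℝ E]
  {Ω : Set E} {G : E → E →L[ℝ] E →L[ℝ] ℝ} {R κ δ₁ δ₂ s s₁ t₁ r : ℝ}
  {u u' u'' v v' v'' c c' : ℝ → E}

/-- Along a path of length at most `s` that starts on a curve of length at most `s`, the metric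
differs little from the metric at the origin of the curve. -/
lemma IsCoordSegment.abs_metric_sub_le (hG : AlmostFlat Ω G R κ)
    (hu : IsCoordCurve Ω G κ δ₁ s₁ u u' u'') (hc : IsCoordSegment Ω G r c c')
    (hc0 : c 0 = u s₁) (hr : 0 ≤ r) (hrs : r ≤ s) (hs₁ : 0 ≤ s₁) (hs₁s : s₁ ≤ s)
    {t : ℝ} (ht : t ∈ Icc (0 : ℝ) 1) (w w' : E) :
    |G (c t) w w' - G (u 0) w w'| ≤ 2 * κ * R * s * ‖w‖ * ‖w'‖ := by
  have hκ := hG.nonneg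
  have hR := zero_le_one.trans hG.one_le
  have h1 := hG.abs_sub_le_of_curve hc.hasDeriv (fun _ hτ => hc.norm_velocity_le hG hr hτ) hc.mem
    ht w w'
  have h2 := hu.abs_metric_sub_le hG (right_mem_Icc.2 hs₁) w w'
  rw [hc0] at h1
  have h3 : κ * (R * r) * t * ‖w‖ * ‖w'‖ ≤ κ * (R * s) * 1 * ‖w‖ * ‖w'‖ := by
    have := ht.1
    have := ht.2
    have := hr.trans hrs
    gcongr
  have h4 : κ * R * s₁ * ‖w‖ * ‖w'‖ ≤ κ * R * s * ‖w‖ * ‖w'‖ := by gcongr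
  calc _ ≤ |G (c t) w w' - G (u s₁) w w'| + |G (u s₁) w w' - G (u 0) w w'| := abs_sub_le _ _ _
    _ ≤ _ := by linarith

/-- The rate of change of the squared distance between `u s₁` and `v t₁`, in the metric at the
common starting point: either both points move along their curves, or only `u s₁` moves, which is
not farther along its curve than `v t₁`. -/
lemma endpoint_rate_le (hG : AlmostFlat Ω G R κ)
    (hu : IsCoordCurve Ω G κ δ₁ s₁ u u' u'') (hv : IsCoordCurve Ω G κ δ₂ t₁ v v' v'')
    (hc : IsCoordSegment Ω G r c c') (h0 : u 0 = v 0) (h0' : u' 0 = v' 0)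
    (hc0 : c 0 = u s₁) (hc1 : c 1 = v t₁) (hδ₁ : 0 ≤ δ₁) (hδ₂ : 0 ≤ δ₂) (hr : 0 ≤ r)
    (hrs : r ≤ s) (hs₁ : 0 ≤ s₁) (hs₁s : s₁ ≤ s) (ht₁ : 0 ≤ t₁) (ht₁s : t₁ ≤ 2 * s)
    (hs : 2 * κ * R * s * R ^ 2 ≤ 1) {q' : E} (hq' : q' = v' t₁ ∨ q' = 0 ∧ s₁ ≤ t₁) :
    G (u 0) (c 1 - c 0) (q' - u' s₁) ≤ (6 * δ₁ + 8 * δ₂ + 7 * R * κ) * s ^ 2 := by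
  have hκ := hG.nonneg
  have hR := zero_le_one.trans hG.one_le
  have hs0 : 0 ≤ s := hs₁.trans hs₁s
  have hB := hG.isInnerLike _ (hu.mem 0 (left_mem_Icc.2 hs₁))
  have hsu : κ * R * s₁ * R ^ 2 ≤ 1 := by
    have : κ * R * s₁ * R ^ 2 ≤ κ * R * (2 * s) * R ^ 2 := by gcongr; linarith
    linarith
  have hsv : κ * R * t₁ * R ^ 2 ≤ 1 := by
    have : κ * R * t₁ * R ^ 2 ≤ κ * R * (2 * s) * R ^ 2 := by gcongr
    linarith
  have hu1 : G (u 0) (u' s₁ - u' 0) (u' s₁ - u' 0) ≤ ((2 * δ₁ + R * κ) * s) ^ 2 :=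
    (hu.velocity_sub_le hG hδ₁ hsu (right_mem_Icc.2 hs₁)).trans (by gcongr)
  have hv1 : G (u 0) (v' t₁ - u' 0) (v' t₁ - u' 0) ≤ ((2 * δ₂ + R * κ) * (2 * s)) ^ 2 := by
    rw [h0, h0']
    exact (hv.velocity_sub_le hG hδ₂ hsv (right_mem_Icc.2 ht₁)).trans (by gcongr)
  have hcc : G (u 0) (c 1 - c 0) (c 1 - c 0) ≤ (2 * s) ^ 2 := by
    have h1 := hB.image_sub_le (k := 2 * r) (by positivity) hc.hasDeriv (fun τ hτ => by
      have h2 := (hG.isInnerLike _ (hc.mem τ hτ)).apply_self_le (η := 2 * κ * R * s)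
        (B' := G (u 0)) (by positivity) (fun w w' => by
          rw [abs_sub_comm]
          exact hc.abs_metric_sub_le hG hu hc0 hr hrs hs₁ hs₁s hτ w w') (c' τ)
      rw [hc.speed τ hτ] at h2
      nlinarith [sq_nonneg r]) (right_mem_Icc.2 zero_le_one)
    rw [mul_one] at h1
    exact h1.trans (by gcongr)
  rcases hq' with rfl | ⟨rfl, hst⟩
  · have h1 := hB.sub_apply_self_le (by positivity) (by positivity) hv1 hu1
    rw [sub_sub_sub_cancel_right] at h1
    refine (hB.apply_le_mul (by positivity) (by positivity) hcc h1).trans ?_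
    have : 0 ≤ δ₁ * s ^ 2 := by positivity
    have : 0 ≤ R * κ * s ^ 2 := by positivity
    nlinarith
  · -- progress along the common initial direction is `s₁` for `u`, and `t₁` for `v`
    have he : G (u 0) (u' 0) (u' 0) ≤ 1 ^ 2 := by
      simpa using (hu.unit_speed 0 (left_mem_Icc.2 hs₁)).le
    have he' : G (u 0) (u' 0) (u' 0) = 1 := hu.unit_speed 0 (left_mem_Icc.2 hs₁)
    have h1 := hB.abs_apply_le_mul (by positivity) (by positivity) hcc hu1
    have hu2 := hu.position_sub_le hG hδ₁ hsu (right_mem_Icc.2 hs₁)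
    have hv2 := hv.position_sub_le hG hδ₂ hsv (right_mem_Icc.2 ht₁)
    rw [← h0, ← h0'] at hv2
    have h2 := hB.abs_apply_le_mul (by positivity) zero_le_one hu2 he
    have h3 := hB.abs_apply_le_mul (by positivity) zero_le_one hv2 he
    have h4 : G (u 0) (c 1 - c 0) (0 - u' s₁) = -G (u 0) (c 1 - c 0) (u' s₁ - u' 0) +
        G (u 0) (u s₁ - u 0 - s₁ • u' 0) (u' 0) - G (u 0) (v t₁ - u 0 - t₁ • u' 0) (u' 0)
        + (s₁ - t₁) := by
      rw [hc0, hc1]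
      simp only [map_sub, map_smul, sub_apply, smul_apply, smul_eq_mul, he', map_zero]
      ring
    have h5 : (2 * δ₁ + R * κ) * s₁ * s₁ ≤ (2 * δ₁ + R * κ) * s * s := by gcongr
    have h6 : (2 * δ₂ + R * κ) * t₁ * t₁ ≤ (2 * δ₂ + R * κ) * (2 * s) * (2 * s) := by gcongr
    rw [h4]
    have := (abs_le.1 h1).1
    have := (abs_le.1 h2).2
    have := (abs_le.1 h3).1
    linarith

end Rate

/-! ### The metric in a chart -/

section ChartVector

variable {m : ℕ} {M : Type*} [TopologicalSpace M] [ChartedSpace (Model m) M]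
  (φ : OpenPartialHomeomorph M (Model m))

lemma chartVector_eq_sum (y v : Model m) :
    chartVector φ y v = ∑ i, v i • chartVector φ y (EuclideanSpace.single i 1) := by
  have h : v = ∑ i, v i • EuclideanSpace.single i (1 : ℝ) := by
    ext k
    simp [Finset.sum_apply, Pi.single_apply]
  have h2 : ∀ L : Model m →L[ℝ] TangentSpace (𝓡 m) (φ.symm y),
      L v = ∑ i, v i • L (EuclideanSpace.single i (1 : ℝ)) := by
    intro L
    conv_lhs => rw [h]
    rw [map_sum]
    simp only [map_smul]
  exact h2 (mfderiv (𝓡 m) (𝓡 m) φ.symm y)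

variable {φ} [IsManifold (𝓡 m) ∞ M]

/-- The coordinate vector fields are smooth. -/
lemma contMDiffOn_chartVector (hφ : φ ∈ IsManifold.maximalAtlas (𝓡 m) ∞ M) (v : Model m) :
    ContMDiffOn (𝓡 m) (𝓡 m).tangent ∞
      (fun y => (⟨φ.symm y, chartVector φ y v⟩ : TangentBundle (𝓡 m) M)) φ.target := by
  have h1 := contMDiffOn_symm_of_mem_maximalAtlas hφ
  have h2 := h1.contMDiffOn_tangentMapWithin (m := ∞) (by simp) φ.open_target.uniqueMDiffOn
  have h3 : ContMDiffOn (𝓡 m) (𝓡 m).tangent ∞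
      (fun y => (⟨y, v⟩ : TangentBundle (𝓡 m) (Model m))) φ.target :=
    contMDiffOn_vectorSpace_iff_contDiffOn.2 contDiffOn_const
  refine (h2.comp h3 (fun y hy => hy)).congr fun y hy => ?_
  simp only [Function.comp_apply, tangentMapWithin, chartVector]
  rw [mfderivWithin_of_isOpen φ.open_target hy]

end ChartVector

section ChartMetric

variable {m : ℕ} {M : Type*} [MetricSpace M] [ChartedSpace (Model m) M]
  [RiemannianBundle (fun x : M => TangentSpace (𝓡 m) x)]

/-- The metric `∑ g_ij dxⁱ ⊗ dxʲ` in the chart `φ`, at the point with coordinates `y`. -/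
def chartMetric (φ : OpenPartialHomeomorph M (Model m)) (y : Model m) :
    Model m →L[ℝ] Model m →L[ℝ] ℝ :=
  ∑ i, ∑ j, metricMatrix φ y i j •
    (EuclideanSpace.proj i : Model m →L[ℝ] ℝ).smulRight (EuclideanSpace.proj j : Model m →L[ℝ] ℝ)

variable (φ : OpenPartialHomeomorph M (Model m))

lemma chartMetric_apply (y v w : Model m) :
    chartMetric φ y v w = ∑ i, ∑ j, metricMatrix φ y i j * (v i * w j) := by
  simp [chartMetric]

lemma chartMetric_eq_inner (y v w : Model m) :
    chartMetric φ y v w = inner ℝ (chartVector φ y v) (chartVector φ y w) := by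
  rw [chartMetric_apply, chartVector_eq_sum φ y v, chartVector_eq_sum φ y w, sum_inner]
  refine Finset.sum_congr rfl fun i _ => ?_
  rw [inner_sum]
  refine Finset.sum_congr rfl fun j _ => ?_
  rw [real_inner_smul_left, real_inner_smul_right]
  simp only [metricMatrix, Matrix.of_apply]
  ring

lemma chartMetric_self (y v : Model m) : chartMetric φ y v v = ‖chartVector φ y v‖ ^ 2 := by
  rw [chartMetric_eq_inner, real_inner_self_eq_norm_sq]

lemma metricMatrix_symm (y : Model m) (i j : Fin m) :
    metricMatrix φ y i j = metricMatrix φ y j i := by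
  simp only [metricMatrix, Matrix.of_apply]
  exact real_inner_comm _ _

lemma metricDeriv_symm (y : Model m) (l i j : Fin m) :
    metricDeriv φ l i j y = metricDeriv φ l j i y := by
  simp only [metricDeriv, metricMatrix_symm φ _ i j]

lemma chartMetric_single (y : Model m) (i j : Fin m) :
    chartMetric φ y (EuclideanSpace.single i 1) (EuclideanSpace.single j 1) =
      metricMatrix φ y i j := by
  rw [chartMetric_eq_inner]
  rfl

lemma dotProduct_metricMatrix_mulVec (y v : Model m) :
    (v.ofLp ⬝ᵥ (metricMatrix φ y).mulVec v.ofLp) = chartMetric φ y v v := by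
  rw [chartMetric_apply]
  simp only [dotProduct, Matrix.mulVec, Finset.mul_sum]
  refine Finset.sum_congr rfl fun i _ => Finset.sum_congr rfl fun j _ => ?_
  ring

variable {φ} {C μ : ℝ}

lemma ChartBounds.le_chartMetric (h : ChartBounds φ C μ) {y : Model m} (hy : y ∈ φ.target)
    (v : Model m) : C⁻¹ * ‖v‖ ^ 2 ≤ chartMetric φ y v v := by
  have := (h.lower y hy).dotProduct_mulVec_nonneg v.ofLp
  rw [Matrix.sub_mulVec, dotProduct_sub, star_trivial, dotProduct_metricMatrix_mulVec,
    Matrix.smul_mulVec, Matrix.one_mulVec, dotProduct_smul, smul_eq_mul] at this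
  have h2 : v.ofLp ⬝ᵥ v.ofLp = ‖v‖ ^ 2 := by
    rw [EuclideanSpace.real_norm_sq_eq]
    simp [dotProduct, sq]
  rw [h2] at this
  linarith

lemma ChartBounds.chartMetric_le (h : ChartBounds φ C μ) {y : Model m} (hy : y ∈ φ.target)
    (v : Model m) : chartMetric φ y v v ≤ C * ‖v‖ ^ 2 := by
  have := (h.upper y hy).dotProduct_mulVec_nonneg v.ofLp
  rw [Matrix.sub_mulVec, dotProduct_sub, star_trivial, dotProduct_metricMatrix_mulVec,
    Matrix.smul_mulVec, Matrix.one_mulVec, dotProduct_smul, smul_eq_mul] at this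
  have h2 : v.ofLp ⬝ᵥ v.ofLp = ‖v‖ ^ 2 := by
    rw [EuclideanSpace.real_norm_sq_eq]
    simp [dotProduct, sq]
  rw [h2] at this
  linarith

lemma ChartBounds.isInnerLike (h : ChartBounds φ C μ) (hC : 0 < C) {y : Model m}
    (hy : y ∈ φ.target) : IsInnerLike (max C 1) (chartMetric φ y) where
  symm v w := by
    rw [chartMetric_eq_inner, chartMetric_eq_inner]
    exact real_inner_comm _ _
  lower v := by
    have h1 := h.le_chartMetric hy v
    rw [inv_mul_le_iff₀ hC] at h1
    refine h1.trans ?_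
    have h3 : 0 ≤ chartMetric φ y v v := by rw [chartMetric_self]; positivity
    gcongr
    nlinarith [le_max_left C 1, le_max_right C 1]
  upper v := by
    refine (h.chartMetric_le hy v).trans ?_
    gcongr
    nlinarith [le_max_left C 1, le_max_right C 1]

/-- The Christoffel symbols determine the derivatives of the metric:
`∂_l g_ij = ∑_k g_jk Γ_li^k + ∑_k g_ik Γ_lj^k`. -/
lemma ChartBounds.metricDeriv_eq (h : ChartBounds φ C μ) (hC : 0 < C) {y : Model m}
    (hy : y ∈ φ.target) (l i j : Fin m) :
    metricDeriv φ l i j y = ∑ k, metricMatrix φ y j k * christoffel φ l i k y +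
      ∑ k, metricMatrix φ y i k * christoffel φ l j k y := by
  have hdet : IsUnit (metricMatrix φ y).det := by
    rw [isUnit_iff_ne_zero]
    intro h0
    obtain ⟨v, hv, hv0⟩ := Matrix.exists_mulVec_eq_zero_iff.2 h0
    have h1 := h.le_chartMetric hy (WithLp.toLp 2 v)
    rw [← dotProduct_metricMatrix_mulVec] at h1
    change _ ≤ v ⬝ᵥ (metricMatrix φ y).mulVec v at h1
    rw [hv0, dotProduct_zero] at h1
    have h2 : WithLp.toLp 2 v ≠ (0 : Model m) := by simpa using hv
    have h3 : 0 < C⁻¹ * ‖WithLp.toLp 2 v‖ ^ 2 := by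
      have := norm_pos_iff.2 h2
      positivity
    linarith
  have key : ∀ a b n : Fin m, ∑ k, metricMatrix φ y n k * christoffel φ a b k y =
      1 / 2 * (metricDeriv φ a b n y + metricDeriv φ b a n y - metricDeriv φ n a b y) := by
    intro a b n
    set d : Fin m → ℝ := fun l =>
      metricDeriv φ a b l y + metricDeriv φ b a l y - metricDeriv φ l a b y with hd
    have h1 : (metricMatrix φ y).mulVec ((metricMatrix φ y)⁻¹.mulVec d) = d := by
      rw [Matrix.mulVec_mulVec, Matrix.mul_nonsing_inv _ hdet, Matrix.one_mulVec]
    have h2 := congrFun h1 n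
    simp only [Matrix.mulVec, dotProduct] at h2
    change _ = 1 / 2 * d n
    rw [← h2, Finset.mul_sum]
    refine Finset.sum_congr rfl fun k _ => ?_
    simp only [christoffel, hd]
    ring
  rw [key, key, metricDeriv_symm φ y l j i, metricDeriv_symm φ y i l j, metricDeriv_symm φ y j l i]
  ring

lemma ChartBounds.abs_metricMatrix_le (h : ChartBounds φ C μ) (hC : 0 < C) {y : Model m}
    (hy : y ∈ φ.target) (i j : Fin m) : |metricMatrix φ y i j| ≤ max C 1 ^ 2 := by
  have hI := h.isInnerLike hC hy
  have h0 : 0 ≤ max C 1 := hC.le.trans (le_max_left _ _)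
  have h1 : ∀ k : Fin m, chartMetric φ y (EuclideanSpace.single k 1) (EuclideanSpace.single k 1) ≤
      max C 1 ^ 2 := fun k => by simpa using hI.upper (EuclideanSpace.single k 1)
  rw [← chartMetric_single, sq]
  exact hI.abs_apply_le_mul h0 h0 (h1 i) (h1 j)

lemma ChartBounds.abs_metricDeriv_le (h : ChartBounds φ C μ) (hC : 0 < C) {y : Model m}
    (hy : y ∈ φ.target) (l i j : Fin m) :
    |metricDeriv φ l i j y| ≤ 2 * m * max C 1 ^ 2 * |μ| := by
  have key : ∀ a b n : Fin m, |∑ k, metricMatrix φ y n k * christoffel φ a b k y| ≤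
      m * (max C 1 ^ 2 * |μ|) := by
    intro a b n
    refine (Finset.abs_sum_le_sum_abs _ _).trans ?_
    refine (Finset.sum_le_card_nsmul _ _ (max C 1 ^ 2 * |μ|) fun k _ => ?_).trans (by simp)
    rw [abs_mul]
    exact mul_le_mul (h.abs_metricMatrix_le hC hy n k)
      ((h.christoffel_le y hy a b k).trans (le_abs_self _)) (abs_nonneg _) (by positivity)
  rw [h.metricDeriv_eq hC hy]
  refine (abs_add_le _ _).trans ?_
  have := key l i j
  have := key l j i
  linarith

lemma contDiffOn_metricMatrix [IsManifold (𝓡 m) ∞ M] [IsContMDiffRiemannianBundle (𝓡 m) ∞ (Model m)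
      (fun x : M => TangentSpace (𝓡 m) x)]
    (hφ : φ ∈ IsManifold.maximalAtlas (𝓡 m) ∞ M) (i j : Fin m) :
    ContDiffOn ℝ ∞ (fun y => metricMatrix φ y i j) φ.target := by
  rw [← contMDiffOn_iff_contDiffOn]
  exact (contMDiffOn_chartVector hφ _).inner_bundle (contMDiffOn_chartVector hφ _)

end ChartMetric

/-! ### Bounded Christoffel symbols make the chart almost flat -/

section Flatness

variable {m : ℕ} {M : Type*} [MetricSpace M] [ChartedSpace (Model m) M]
  [RiemannianBundle (fun x : M => TangentSpace (𝓡 m) x)]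
  {φ : OpenPartialHomeomorph M (Model m)} {C μ : ℝ}

/-- The factor by which the bound of the Christoffel symbols has to be multiplied to bound the
derivative of the metric and the Christoffel term `Γ(v, v)` of a unit vector `v`. -/
def flatnessConst (m : ℕ) (C : ℝ) : ℝ := 3 * m ^ 4 * max C 1 ^ 2

lemma ChartBounds.norm_fderiv_metricMatrix_le (h : ChartBounds φ C μ) (hC : 0 < C) {y : Model m}
    (hy : y ∈ φ.target) (i j : Fin m) :
    ‖fderiv ℝ (fun z => metricMatrix φ z i j) y‖ ≤ m * (2 * m * max C 1 ^ 2 * |μ|) := by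
  refine ContinuousLinearMap.opNorm_le_bound _ (by positivity) fun z => ?_
  have hz : z = ∑ l, z l • EuclideanSpace.single l (1 : ℝ) := by
    ext k
    simp [Finset.sum_apply, Pi.single_apply]
  conv_lhs => rw [hz, map_sum]
  refine (norm_sum_le _ _).trans ((Finset.sum_le_card_nsmul _ _
    (‖z‖ * (2 * m * max C 1 ^ 2 * |μ|)) fun l _ => ?_).trans (by simp; linarith))
  rw [map_smul, norm_smul]
  exact mul_le_mul (PiLp.norm_apply_le z l) (h.abs_metricDeriv_le hC hy l i j) (norm_nonneg _)
    (norm_nonneg _)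

/-- A chart with bounded metric and Christoffel symbols is almost flat. -/
lemma ChartBounds.almostFlat [IsManifold (𝓡 m) ∞ M]
    [IsContMDiffRiemannianBundle (𝓡 m) ∞ (Model m) (fun x : M => TangentSpace (𝓡 m) x)]
    (h : ChartBounds φ C μ) (hC : 0 < C) (hφ : φ ∈ IsManifold.maximalAtlas (𝓡 m) ∞ M) :
    AlmostFlat φ.target (chartMetric φ) (max C 1) (flatnessConst m C * |μ|) := by
  have hdiff : ∀ y ∈ φ.target, ∀ i j,
      DifferentiableAt ℝ (fun z => metricMatrix φ z i j) y := fun y hy i j =>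
    ((contDiffOn_metricMatrix hφ i j).differentiableOn (by simp)).differentiableAt
      (φ.open_target.mem_nhds hy)
  have hder : ∀ y ∈ φ.target, ∀ v w, HasFDerivAt (fun z => chartMetric φ z v w)
      (∑ i, ∑ j, (v i * w j) • fderiv ℝ (fun z => metricMatrix φ z i j) y) y := by
    intro y hy v w
    simp only [chartMetric_apply]
    exact HasFDerivAt.fun_sum fun i _ => HasFDerivAt.fun_sum fun j _ =>
      (hdiff y hy i j).hasFDerivAt.mul_const (v i * w j)
  refine ⟨φ.open_target, le_max_right _ _, by unfold flatnessConst; positivity,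
    fun y hy => h.isInnerLike hC hy, ?_, fun y hy v w => (hder y hy v w).differentiableAt, ?_⟩
  · simp only [chartMetric_apply]
    refine continuousOn_finsetSum _ fun i _ => continuousOn_finsetSum _ fun j _ => ?_
    refine ContinuousOn.mul ?_ (by fun_prop)
    exact (contDiffOn_metricMatrix hφ i j).continuousOn.comp continuousOn_fst fun p hp => hp.1
  · intro y hy v w
    rw [(hder y hy v w).fderiv]
    have hm : (0 : ℝ) ≤ m := m.cast_nonneg
    have hsum : ∀ (f : Fin m → Model m →L[ℝ] ℝ) (b : ℝ), (∀ i, ‖f i‖ ≤ b) →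
        ‖∑ i, f i‖ ≤ m * b := fun f b hf =>
      (norm_sum_le _ _).trans ((Finset.sum_le_card_nsmul _ _ b fun i _ => hf i).trans (by simp))
    refine (hsum _ _ fun i => hsum _ (‖v‖ * ‖w‖ * (m * (2 * m * max C 1 ^ 2 * |μ|)))
      fun j => ?_).trans ?_
    · rw [norm_smul, norm_mul]
      gcongr
      · exact PiLp.norm_apply_le v i
      · exact PiLp.norm_apply_le w j
      · exact h.norm_fderiv_metricMatrix_le hC hy i j
    · unfold flatnessConst
      have : 0 ≤ (m : ℝ) ^ 4 * max C 1 ^ 2 * |μ| * ‖v‖ * ‖w‖ := by positivity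
      nlinarith

/-- The Christoffel term of the geodesic equation of a unit vector is small. -/
lemma ChartBounds.norm_christoffel_le (h : ChartBounds φ C μ) {y : Model m}
    (hy : y ∈ φ.target) {v : Model m} (hv : ‖v‖ ≤ max C 1) :
    ‖(WithLp.toLp 2 fun k => ∑ i, ∑ j, christoffel φ i j k y * v i * v j : Model m)‖ ≤
      flatnessConst m C * |μ| := by
  have hcoord : ∀ k, |∑ i, ∑ j, christoffel φ i j k y * v i * v j| ≤
      m * (m * (|μ| * max C 1 * max C 1)) := by
    intro k
    have hsum : ∀ (f : Fin m → ℝ) (b : ℝ), (∀ i, |f i| ≤ b) → |∑ i, f i| ≤ m * b := fun f b hf =>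
      (Finset.abs_sum_le_sum_abs _ _).trans
        ((Finset.sum_le_card_nsmul _ _ b fun i _ => hf i).trans (by simp))
    refine hsum _ _ fun i => hsum _ _ fun j => ?_
    rw [abs_mul, abs_mul]
    have h1 := (h.christoffel_le y hy i j k).trans (le_abs_self _)
    have h2 : |v i| ≤ max C 1 := (PiLp.norm_apply_le v i).trans hv
    have h3 : |v j| ≤ max C 1 := (PiLp.norm_apply_le v j).trans hv
    exact mul_le_mul (mul_le_mul h1 h2 (abs_nonneg _) (abs_nonneg _)) h3 (abs_nonneg _)
      (by positivity)
  set w : Model m := WithLp.toLp 2 fun k => ∑ i, ∑ j, christoffel φ i j k y * v i * v j with hw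
  have h1 : w = ∑ k, w k • EuclideanSpace.single k (1 : ℝ) := by
    ext k
    simp [Finset.sum_apply, Pi.single_apply]
  rw [h1]
  refine (norm_sum_le _ _).trans ((Finset.sum_le_card_nsmul _ _
    (m * (m * (|μ| * max C 1 * max C 1))) fun k _ => ?_).trans ?_)
  · rw [norm_smul, PiLp.norm_single, norm_one, mul_one]
    exact hcoord k
  · simp only [Finset.card_univ, Fintype.card_fin, nsmul_eq_mul]
    unfold flatnessConst
    have hm : (m : ℝ) ^ 3 ≤ m ^ 4 := by
      rcases m.eq_zero_or_pos with rfl | hm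
      · simp
      · exact_mod_cast Nat.pow_le_pow_right hm (by norm_num)
    have h2 : 0 ≤ |μ| * max C 1 ^ 2 := by positivity
    have h3 : 0 ≤ (m : ℝ) ^ 4 * (|μ| * max C 1 ^ 2) := by positivity
    nlinarith [mul_le_mul_of_nonneg_right hm h2]

end Flatness

/-! ### Curves in a chart -/

section ChartCurve

variable {m : ℕ} {M : Type*} [TopologicalSpace M] [ChartedSpace (Model m) M]
  {φ : OpenPartialHomeomorph M (Model m)}

lemma mdifferentiableAt_symm (hφ : φ ∈ IsManifold.maximalAtlas (𝓡 m) ∞ M) {y : Model m}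
    (hy : y ∈ φ.target) : MDifferentiableAt (𝓡 m) (𝓡 m) φ.symm y :=
  (contMDiffAt_symm_of_mem_maximalAtlas hφ hy).mdifferentiableAt (by simp)

/-- The velocity of a curve given in the chart. -/
lemma velocity_symm_comp (hφ : φ ∈ IsManifold.maximalAtlas (𝓡 m) ∞ M) {x : ℝ → Model m}
    {x' : Model m} {S : Set ℝ} {t : ℝ} (hx : HasDerivWithinAt x x' S t)
    (hS : UniqueDiffWithinAt ℝ S t) (ht : x t ∈ φ.target) :
    velocity (fun τ => φ.symm (x τ)) S t = chartVector φ (x t) x' := by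
  have h1 : HasMFDerivWithinAt 𝓘(ℝ, ℝ) (𝓡 m) x S t (ContinuousLinearMap.toSpanSingleton ℝ x') :=
    hx.hasFDerivWithinAt.hasMFDerivWithinAt
  have h2 := (mdifferentiableAt_symm hφ ht).hasMFDerivAt.comp_hasMFDerivWithinAt t h1
  have h3 := h2.mfderivWithin hS.uniqueMDiffWithinAt
  have h4 : velocity (fun τ => φ.symm (x τ)) S t =
      (mfderivWithin 𝓘(ℝ, ℝ) (𝓡 m) (φ.symm ∘ x) S t) (1 : ℝ) := rfl
  rw [h4, h3]
  change mfderiv (𝓡 m) (𝓡 m) φ.symm (x t) (ContinuousLinearMap.toSpanSingleton ℝ x' (1 : ℝ)) = _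
  rw [ContinuousLinearMap.toSpanSingleton_apply, one_smul]
  rfl

lemma contDiffWithinAt_chart_comp (hφ : φ ∈ IsManifold.maximalAtlas (𝓡 m) ∞ M) {γ : ℝ → M}
    {S : Set ℝ} {t : ℝ} (hγ : ContMDiffWithinAt 𝓘(ℝ, ℝ) (𝓡 m) 2 γ S t) (ht : γ t ∈ φ.source) :
    ContDiffWithinAt ℝ 2 (fun τ => φ (γ τ)) S t := by
  rw [← contMDiffWithinAt_iff_contDiffWithinAt]
  exact ((contMDiffAt_of_mem_maximalAtlas hφ ht).of_le (by norm_cast)).comp_contMDiffWithinAt t hγ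

lemma hasDerivWithinAt_chart_comp (hφ : φ ∈ IsManifold.maximalAtlas (𝓡 m) ∞ M) {γ : ℝ → M}
    {S : Set ℝ} {t : ℝ} (hγ : ContMDiffWithinAt 𝓘(ℝ, ℝ) (𝓡 m) 2 γ S t) (ht : γ t ∈ φ.source) :
    HasDerivWithinAt (fun τ => φ (γ τ)) (derivWithin (fun τ => φ (γ τ)) S t) S t :=
  ((contDiffWithinAt_chart_comp hφ hγ ht).differentiableWithinAt
    (by norm_num)).hasDerivWithinAt

/-- The velocity of a curve, as an element of the tangent bundle, is the one found in the
chart. -/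
lemma velocity_eq_chartVector (hφ : φ ∈ IsManifold.maximalAtlas (𝓡 m) ∞ M) {γ : ℝ → M}
    {S : Set ℝ} {t : ℝ} (hS : UniqueDiffWithinAt ℝ S t)
    (hγ : ContMDiffWithinAt 𝓘(ℝ, ℝ) (𝓡 m) 2 γ S t) (ht : γ t ∈ φ.source) :
    (⟨γ t, velocity γ S t⟩ : TangentBundle (𝓡 m) M) =
      ⟨φ.symm (φ (γ t)), chartVector φ (φ (γ t)) (derivWithin (fun τ => φ (γ τ)) S t)⟩ := by
  have hd := ((contDiffWithinAt_chart_comp hφ hγ ht).differentiableWithinAt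
    (by norm_num)).hasDerivWithinAt
  rw [← velocity_symm_comp hφ hd hS (φ.map_source ht)]
  have h0 : φ.symm (φ (γ t)) = γ t := φ.left_inv ht
  have hev : γ =ᶠ[𝓝[S] t] fun τ => φ.symm (φ (γ τ)) := by
    filter_upwards [hγ.continuousWithinAt (φ.open_source.mem_nhds ht)] with τ hτ
    exact (φ.left_inv hτ).symm
  have h1 := hev.mfderivWithin_eq (I := 𝓘(ℝ, ℝ)) (I' := 𝓡 m) h0.symm
  have h2 := congrArg (fun L : ℝ →L[ℝ] Model m => L 1) h1
  refine TotalSpace.ext h0.symm ?_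
  exact heq_of_eq h2

end ChartCurve

section Curves

variable {m : ℕ} {M : Type*} [MetricSpace M] [ChartedSpace (Model m) M]
  [RiemannianBundle (fun x : M => TangentSpace (𝓡 m) x)]
  {φ : OpenPartialHomeomorph M (Model m)} {C μ : ℝ}

lemma norm_chartVector_derivWithin (hφ : φ ∈ IsManifold.maximalAtlas (𝓡 m) ∞ M) {γ : ℝ → M}
    {S : Set ℝ} {t : ℝ} (hS : UniqueDiffWithinAt ℝ S t)
    (hγ : ContMDiffWithinAt 𝓘(ℝ, ℝ) (𝓡 m) 2 γ S t) (ht : γ t ∈ φ.source) :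
    ‖chartVector φ (φ (γ t)) (derivWithin (fun τ => φ (γ τ)) S t)‖ =
      ‖(velocity γ S t : TangentSpace (𝓡 m) (γ t))‖ :=
  (congrArg (fun X : TangentBundle (𝓡 m) M => ‖X.2‖)
    (velocity_eq_chartVector hφ hS hγ ht)).symm

lemma IsUnitSpeedCurve.isCoordCurve {γ : ℝ → M} {ℓ δ T : ℝ}
    (hγ : IsUnitSpeedCurve (m := m) γ ℓ δ) (hℓ : 0 < ℓ) (hT : T ≤ ℓ)
    (hφ : φ ∈ IsManifold.maximalAtlas (𝓡 m) ∞ M) (h : ChartBounds φ C μ) (hC : 0 < C)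
    (hmem : ∀ t ∈ Icc 0 T, γ t ∈ φ.source) :
    IsCoordCurve φ.target (chartMetric φ) (flatnessConst m C * |μ|) δ T (fun τ => φ (γ τ))
      (derivWithin (fun τ => φ (γ τ)) (Icc 0 ℓ))
      (derivWithin (derivWithin (fun τ => φ (γ τ)) (Icc 0 ℓ)) (Icc 0 ℓ)) := by
  have hsub : Icc 0 T ⊆ Icc 0 ℓ := Icc_subset_Icc_right hT
  have hS := uniqueDiffOn_Icc hℓ
  have hunit : ∀ t ∈ Icc 0 T, chartMetric φ (φ (γ t))
      (derivWithin (fun τ => φ (γ τ)) (Icc 0 ℓ) t)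
      (derivWithin (fun τ => φ (γ τ)) (Icc 0 ℓ) t) = 1 := fun t ht => by
    rw [chartMetric_self, norm_chartVector_derivWithin hφ (hS t (hsub ht))
      (hγ.contMDiffOn t (hsub ht)) (hmem t ht), hγ.unit_speed t (hsub ht), one_pow]
  refine ⟨fun t ht => φ.map_source (hmem t ht), fun t ht => ?_, fun t ht => ?_, hunit,
    fun t ht => ?_⟩
  · exact (hasDerivWithinAt_chart_comp hφ (hγ.contMDiffOn t (hsub ht)) (hmem t ht)).mono hsub
  · have h2 := contDiffWithinAt_chart_comp hφ (hγ.contMDiffOn t (hsub ht)) (hmem t ht)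
    exact ((h2.derivWithin hS (m := 1) (by norm_num) (hsub ht)).differentiableWithinAt
      one_ne_zero).hasDerivWithinAt.mono hsub
  · refine ⟨covAccelCoord φ γ (Icc 0 ℓ) t, ?_, ?_⟩
    · rw [chartMetric_self]
      have := hγ.curvature_le t (hsub ht) φ hφ (hmem t ht)
      gcongr
    · have hy := φ.map_source (hmem t ht)
      have hv := (h.isInnerLike hC hy).norm_le (zero_le_one.trans (le_max_right C 1)) zero_le_one
        (by rw [hunit t ht, one_pow])
      rw [mul_one] at hv
      refine le_trans (le_of_eq ?_) (h.norm_christoffel_le hy hv)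
      rw [norm_sub_rev]
      congr 1
      ext k
      simp [covAccelCoord]

lemma IsMinimalGeodesic.isCoordSegment {γ : ℝ → M} {x y : M}
    (hγ : IsMinimalGeodesic (m := m) γ x y)
    (hφ : φ ∈ IsManifold.maximalAtlas (𝓡 m) ∞ M) (hmem : ∀ t ∈ Icc (0 : ℝ) 1, γ t ∈ φ.source) :
    IsCoordSegment φ.target (chartMetric φ) (dist x y) (fun τ => φ (γ τ))
      (derivWithin (fun τ => φ (γ τ)) (Icc 0 1)) := by
  have hS := uniqueDiffOn_Icc (zero_lt_one' ℝ)
  refine ⟨fun t ht => φ.map_source (hmem t ht), fun t ht =>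
    hasDerivWithinAt_chart_comp hφ (hγ.contMDiffOn t ht) (hmem t ht), fun t ht => ?_,
    fun t ht => ?_⟩
  · exact ((contDiffWithinAt_chart_comp hφ (hγ.contMDiffOn t ht) (hmem t ht)).derivWithin hS
      (m := 1) (by norm_num) ht).continuousWithinAt
  · rw [chartMetric_self, norm_chartVector_derivWithin hφ (hS t ht) (hγ.contMDiffOn t ht)
      (hmem t ht), hγ.minimal t ht]

variable [IsRiemannianManifold (𝓡 m) M]

/-- The squared distance of the end points is at most the energy of a path in the chart. -/
lemma dist_sq_le_energy (hφ : φ ∈ IsManifold.maximalAtlas (𝓡 m) ∞ M) {R κ : ℝ}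
    (hG : AlmostFlat φ.target (chartMetric φ) R κ) {x x' : ℝ → Model m}
    (hx : ∀ t ∈ Icc (0 : ℝ) 1, HasDerivWithinAt x (x' t) (Icc 0 1) t)
    (hx' : ContinuousOn x' (Icc 0 1)) (hmem : ∀ t ∈ Icc (0 : ℝ) 1, x t ∈ φ.target) :
    dist (φ.symm (x 0)) (φ.symm (x 1)) ^ 2 ≤
      ∫ t in (0 : ℝ)..1, chartMetric φ (x t) (x' t) (x' t) := by
  have hS := uniqueDiffOn_Icc (zero_lt_one' ℝ)
  have hxc : ContinuousOn x (Icc 0 1) := fun t ht => (hx t ht).continuousWithinAt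
  have hx1 : ContDiffOn ℝ 1 x (Icc 0 1) := by
    rw [contDiffOn_one_iff_derivWithin hS]
    refine ⟨fun t ht => (hx t ht).differentiableWithinAt, hx'.congr fun t ht => ?_⟩
    exact (hx t ht).derivWithin (hS t ht)
  have hsm : ContMDiffOn 𝓘(ℝ, ℝ) (𝓡 m) 1 (fun t => φ.symm (x t)) (Icc 0 1) :=
    ((contMDiffOn_symm_of_mem_maximalAtlas hφ).of_le (by norm_cast)).comp
      (contMDiffOn_iff_contDiffOn.2 hx1) hmem
  set n : ℝ → ℝ := fun t => Real.sqrt (chartMetric φ (x t) (x' t) (x' t)) with hn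
  have hgc : ContinuousOn (fun t => chartMetric φ (x t) (x' t) (x' t)) (Icc 0 1) :=
    hG.continuousOn_apply hxc hmem hx' hx'
  have hnc : ContinuousOn n (Icc 0 1) := hgc.sqrt
  have hlen : edist (φ.symm (x 0)) (φ.symm (x 1)) ≤
      ENNReal.ofReal (∫ t in Icc (0 : ℝ) 1, n t) := by
    rw [IsRiemannianManifold.out (I := 𝓡 m) (φ.symm (x 0)) (φ.symm (x 1))]
    refine (Manifold.riemannianEDist_le_pathELength hsm rfl rfl zero_le_one).trans ?_
    rw [Manifold.pathELength_eq_lintegral_mfderivWithin_Icc,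
      MeasureTheory.ofReal_integral_eq_lintegral_ofReal
        (hnc.integrableOn_Icc) (Eventually.of_forall fun t => Real.sqrt_nonneg _)]
    refine le_of_eq (MeasureTheory.setLIntegral_congr_fun measurableSet_Icc fun t ht => ?_)
    have h1 := velocity_symm_comp hφ (hx t ht) (hS t ht) (hmem t ht)
    change ‖velocity (fun τ => φ.symm (x τ)) (Icc 0 1) t‖ₑ = _
    rw [h1, hn]
    simp only
    rw [chartMetric_self, Real.sqrt_sq (norm_nonneg _), ofReal_norm]
  rw [edist_dist, ENNReal.ofReal_le_ofReal_iff (MeasureTheory.integral_nonneg fun t =>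
    Real.sqrt_nonneg _), MeasureTheory.integral_Icc_eq_integral_Ioc,
    ← intervalIntegral.integral_of_le zero_le_one] at hlen
  set d := dist (φ.symm (x 0)) (φ.symm (x 1)) with hd
  -- the arithmetic-geometric mean inequality turns length into energy
  have h2 : ∫ t in (0 : ℝ)..1, 2 * d * n t ≤
      ∫ t in (0 : ℝ)..1, (chartMetric φ (x t) (x' t) (x' t) + d ^ 2) := by
    refine intervalIntegral.integral_mono_on zero_le_one
      ((continuousOn_const.mul hnc).intervalIntegrable_of_Icc zero_le_one)
      ((hgc.add continuousOn_const).intervalIntegrable_of_Icc zero_le_one) fun t ht => ?_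
    have h3 : n t ^ 2 = chartMetric φ (x t) (x' t) (x' t) :=
      Real.sq_sqrt (by rw [chartMetric_self]; positivity)
    nlinarith [sq_nonneg (n t - d)]
  rw [intervalIntegral.integral_const_mul,
    intervalIntegral.integral_add (hgc.intervalIntegrable_of_Icc zero_le_one) (by simp)] at h2
  have h3 : 2 * d * d ≤ 2 * d * ∫ t in (0 : ℝ)..1, n t := by
    have : 0 ≤ d := dist_nonneg
    gcongr
  simp only [intervalIntegral.integral_const, sub_zero, one_smul] at h2
  nlinarith

lemma IsUnitSpeedCurve.dist_le {γ : ℝ → M} {ℓ δ t : ℝ}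
    (hγ : IsUnitSpeedCurve (m := m) γ ℓ δ) (ht : t ∈ Icc 0 ℓ) : dist (γ 0) (γ t) ≤ t := by
  have hsm : ContMDiffOn 𝓘(ℝ, ℝ) (𝓡 m) 1 γ (Icc 0 t) :=
    (hγ.contMDiffOn.mono (Icc_subset_Icc_right ht.2)).of_le (by norm_num)
  have hlen : edist (γ 0) (γ t) ≤ ENNReal.ofReal t := by
    rw [IsRiemannianManifold.out (I := 𝓡 m) (γ 0) (γ t)]
    refine (Manifold.riemannianEDist_le_pathELength hsm rfl rfl ht.1).trans ?_
    rw [Manifold.pathELength_eq_lintegral_mfderiv_Ioo]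
    have h1 : ∀ τ ∈ Ioo 0 t, ‖mfderiv 𝓘(ℝ, ℝ) (𝓡 m) γ τ 1‖ₑ = 1 := by
      intro τ hτ
      have hτ' : Icc 0 ℓ ∈ 𝓝 τ := Icc_mem_nhds hτ.1 (hτ.2.trans_le ht.2)
      rw [← mfderivWithin_of_mem_nhds hτ']
      change ‖velocity γ (Icc 0 ℓ) τ‖ₑ = 1
      rw [← ofReal_norm, hγ.unit_speed τ (mem_of_mem_nhds hτ'), ENNReal.ofReal_one]
    rw [MeasureTheory.setLIntegral_congr_fun measurableSet_Ioo h1]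
    simp
  rwa [edist_dist, ENNReal.ofReal_le_ofReal_iff ht.1] at hlen

end Curves

/-! ### The distance between the two curves -/

lemma distToCurve_le_dist {M : Type*} [MetricSpace M] {β : ℝ → M} {ℓ t : ℝ} {x : M}
    (ht : t ∈ Icc 0 ℓ) : distToCurve β ℓ x ≤ dist x (β t) :=
  Metric.infDist_le_dist_of_mem (mem_image_of_mem β ht)

section Deviation

variable {m : ℕ} {M : Type*} [MetricSpace M] [ChartedSpace (Model m) M]
  [RiemannianBundle (fun x : M => TangentSpace (𝓡 m) x)]
  [IsManifold (𝓡 m) ∞ M]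
  [IsContMDiffRiemannianBundle (𝓡 m) ∞ (Model m) (fun x : M => TangentSpace (𝓡 m) x)]
  [IsRiemannianManifold (𝓡 m) M]
  {φ : OpenPartialHomeomorph M (Model m)} {C μ δ₁ δ₂ a b s : ℝ} {α β : ℝ → M}

/-- The right upper derivative of the squared distance to `β` along `α`. -/
lemma eventually_distToCurve_sq_le (hC : 0 < C) (hα : IsUnitSpeedCurve (m := m) α a δ₁)
    (hβ : IsUnitSpeedCurve (m := m) β b δ₂)
    (hvel : (⟨α 0, velocity α (Icc 0 a) 0⟩ : TangentBundle (𝓡 m) M) =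
      ⟨β 0, velocity β (Icc 0 b) 0⟩)
    (hφ : φ ∈ IsManifold.maximalAtlas (𝓡 m) ∞ M) (h : ChartBounds φ C μ)
    (hδ₁ : 0 ≤ δ₁) (hδ₂ : 0 ≤ δ₂) (hs : 0 < s) (hsa : s ≤ a) (hsb : s ≤ b)
    (hαφ : ∀ t ∈ Icc 0 s, α t ∈ φ.source)
    (hsmall : 2 * (flatnessConst m C * |μ|) * max C 1 * s * max C 1 ^ 2 ≤ 1)
    {s₁ t₁ : ℝ} (hs₁ : s₁ ∈ Ico 0 s) (ht₁ : t₁ ∈ Icc 0 b) (ht₁s : t₁ ≤ 2 * s)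
    (hβφ : ∀ t ∈ Icc 0 t₁, β t ∈ φ.source)
    (hdist : dist (α s₁) (β t₁) = distToCurve β b (α s₁))
    {γ : ℝ → M} (hγ : IsMinimalGeodesic (m := m) γ (α s₁) (β t₁))
    (hγφ : ∀ τ ∈ Icc (0 : ℝ) 1, γ τ ∈ φ.source) {K : ℝ}
    (hK : (12 * δ₁ + 16 * δ₂ + 32 * max C 1 ^ 3 * (flatnessConst m C * |μ|)) * s ^ 2 < K) :
    ∀ᶠ e in 𝓝[>] (0 : ℝ),
      distToCurve β b (α (s₁ + e)) ^ 2 ≤ distToCurve β b (α s₁) ^ 2 + K * e := by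
  have hG := h.almostFlat hC hφ
  set κ := flatnessConst m C * |μ| with hκdef
  set R := max C 1 with hRdef
  have hR1 : 1 ≤ R := hG.one_le
  have hR : 0 ≤ R := zero_le_one.trans hR1
  have hκ : 0 ≤ κ := hG.nonneg
  have ha : 0 < a := hs.trans_le hsa
  have hb : 0 < b := hs.trans_le hsb
  have hs₁s := hs₁.2
  have h0s : (0 : ℝ) ∈ Icc 0 s := left_mem_Icc.2 hs.le
  have hα0 : α 0 ∈ φ.source := hαφ 0 h0s
  have hβ0 : β 0 ∈ φ.source := hβφ 0 (left_mem_Icc.2 ht₁.1)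
  have h0αβ : α 0 = β 0 := congrArg (fun X : TangentBundle (𝓡 m) M => X.1) hvel
  have hu := hα.isCoordCurve ha (hs₁s.le.trans hsa) hφ h hC
    fun t ht => hαφ t ⟨ht.1, ht.2.trans hs₁s.le⟩
  have hv := hβ.isCoordCurve hb ht₁.2 hφ h hC hβφ
  have hc := hγ.isCoordSegment hφ hγφ
  set u := fun τ => φ (α τ) with hudef
  set v := fun τ => φ (β τ) with hvdef
  set c := fun τ => φ (γ τ) with hcdef
  set r := dist (α s₁) (β t₁) with hrdef
  have hr : 0 ≤ r := dist_nonneg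
  have hrs : r ≤ s := by
    rw [hdist]
    refine (distToCurve_le_dist (left_mem_Icc.2 hb.le)).trans ?_
    rw [← h0αβ, dist_comm]
    exact (hα.dist_le ⟨hs₁.1, hs₁s.le.trans hsa⟩).trans hs₁s.le
  have h0 : u 0 = v 0 := congrArg φ h0αβ
  have h0' : derivWithin u (Icc 0 a) 0 = derivWithin v (Icc 0 b) 0 := by
    have h1 := velocity_eq_chartVector hφ (uniqueDiffOn_Icc ha 0 (left_mem_Icc.2 ha.le))
      (hα.contMDiffOn 0 (left_mem_Icc.2 ha.le)) hα0
    have h2 := velocity_eq_chartVector hφ (uniqueDiffOn_Icc hb 0 (left_mem_Icc.2 hb.le))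
      (hβ.contMDiffOn 0 (left_mem_Icc.2 hb.le)) hβ0
    rw [h1, h2] at hvel
    change (⟨φ.symm (u 0), chartVector φ (u 0) (derivWithin u (Icc 0 a) 0)⟩ :
      TangentBundle (𝓡 m) M) = ⟨φ.symm (v 0), chartVector φ (v 0) (derivWithin v (Icc 0 b) 0)⟩
      at hvel
    rw [← h0] at hvel
    have h3 : chartVector φ (u 0) (derivWithin u (Icc 0 a) 0) =
        chartVector φ (u 0) (derivWithin v (Icc 0 b) 0) := by
      simpa using hvel
    -- the coordinate vectors at a point are linearly independent, as the metric is definite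
    have hI := h.isInnerLike hC (φ.map_source hα0)
    have h4 : chartVector φ (u 0) (derivWithin u (Icc 0 a) 0 - derivWithin v (Icc 0 b) 0) = 0 := by
      have h5 : chartVector φ (u 0) (derivWithin u (Icc 0 a) 0 - derivWithin v (Icc 0 b) 0) =
        chartVector φ (u 0) (derivWithin u (Icc 0 a) 0) -
          chartVector φ (u 0) (derivWithin v (Icc 0 b) 0) :=
        map_sub (mfderiv (𝓡 m) (𝓡 m) φ.symm (u 0)) _ _
      rw [h5, h3, sub_self]
    have h5 := hI.norm_le hR le_rfl
      (v := derivWithin u (Icc 0 a) 0 - derivWithin v (Icc 0 b) 0) (by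
        rw [chartMetric_self]
        change ‖chartVector φ (u 0) _‖ ^ 2 ≤ _
        rw [h4]
        simp)
    rw [mul_zero, norm_le_zero_iff, sub_eq_zero] at h5
    exact h5
  have hc0 : c 0 = u s₁ := congrArg φ hγ.source
  have hc1 : c 1 = v t₁ := congrArg φ hγ.target
  have hp := hasDerivWithinAt_shift
    (hasDerivWithinAt_chart_comp hφ (hα.contMDiffOn s₁ ⟨hs₁.1, hs₁s.le.trans hsa⟩)
      (hαφ s₁ ⟨hs₁.1, hs₁s.le⟩)) hs₁.1 (hs₁s.trans_le hsa)
  -- the motion `q` of the point on `β`: it follows `β`, or rests if it is the end point of `β`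
  obtain ⟨q, q', hq, hq0, hq', hqcases, hqβ⟩ : ∃ (q : ℝ → Model m) (q' : Model m),
      HasDerivWithinAt q q' (Ici 0) 0 ∧ q 0 = 0 ∧ ‖q'‖ ≤ R ∧
      (q' = derivWithin v (Icc 0 b) t₁ ∨ q' = 0 ∧ s₁ ≤ t₁) ∧
      ∀ᶠ e in 𝓝[>] (0 : ℝ), ∃ t ∈ Icc 0 b, φ.symm (v t₁ + q e) = β t := by
    have hβt : β t₁ ∈ φ.source := hβφ t₁ (right_mem_Icc.2 ht₁.1)
    rcases ht₁.2.lt_or_eq with hlt | heq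
    · refine ⟨_, _, hasDerivWithinAt_shift
        (hasDerivWithinAt_chart_comp hφ (hβ.contMDiffOn t₁ ht₁) hβt) ht₁.1 hlt, by simp,
        hv.norm_velocity_le hG (right_mem_Icc.2 ht₁.1), Or.inl rfl, ?_⟩
      have hshift : Tendsto (fun e : ℝ => t₁ + e) (𝓝[>] 0) (𝓝[Icc 0 b] t₁) := by
        refine tendsto_nhdsWithin_iff.2 ⟨?_, ?_⟩
        · have : Tendsto (fun e : ℝ => t₁ + e) (𝓝 0) (𝓝 (t₁ + 0)) := tendsto_id.const_add t₁
          rw [add_zero] at this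
          exact this.mono_left nhdsWithin_le_nhds
        · filter_upwards [Ioo_mem_nhdsGT (sub_pos.2 hlt)] with e he
          exact ⟨by linarith [he.1, ht₁.1], by linarith [he.2]⟩
      have hev := (hβ.contMDiffOn t₁ ht₁).continuousWithinAt (φ.open_source.mem_nhds hβt)
      filter_upwards [hshift hev, hshift self_mem_nhdsWithin] with e he he'
      refine ⟨t₁ + e, he', ?_⟩
      rw [add_sub_cancel]
      exact φ.left_inv he
    · refine ⟨fun _ => 0, 0, hasDerivWithinAt_const _ _ _, rfl, by simpa using hR,
        Or.inr ⟨rfl, by linarith⟩, Eventually.of_forall fun e => ⟨t₁, ht₁, ?_⟩⟩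
      rw [add_zero]
      exact φ.left_inv hβt
  have hrate := endpoint_rate_le hG hu hv hc h0 h0' hc0 hc1 hδ₁ hδ₂ hr hrs hs₁.1 hs₁s.le ht₁.1
    ht₁s hsmall hqcases
  have hB : ∀ t ∈ Icc (0 : ℝ) 1, ∀ w w',
      |chartMetric φ (c t) w w' - chartMetric φ (u 0) w w'| ≤ 2 * κ * R * s * ‖w‖ * ‖w'‖ :=
    fun t ht w w' => hc.abs_metric_sub_le hG hu hc0 hr hrs hs₁.1 hs₁s.le ht w w'
  have hK' : κ * (R + 1) * R ^ 2 * r ^ 2 +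
      2 * chartMetric φ (u 0) (c 1 - c 0) (q' - derivWithin u (Icc 0 a) s₁) +
      4 * (2 * κ * R * s) * (R * r) * (R + 1) < K := by
    have h1 : κ * (R + 1) * R ^ 2 * r ^ 2 ≤ κ * (R + R) * R ^ 2 * s ^ 2 := by gcongr
    have h2 : 4 * (2 * κ * R * s) * (R * r) * (R + 1) ≤
        4 * (2 * κ * R * s) * (R * s) * (R + R) := by gcongr
    have h3 : R * κ * s ^ 2 ≤ R ^ 3 * κ * s ^ 2 := by
      gcongr
      exact le_self_pow₀ hR1 (by norm_num)
    nlinarith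
  have hev := hc.eventually_energy_le hG hr (by positivity) hB hp (by simp)
    (hu.norm_velocity_le hG (right_mem_Icc.2 hs₁.1)) hq hq0 hq' hK'
  filter_upwards [hev, hqβ, Ioo_mem_nhdsGT (sub_pos.2 hs₁s)] with e he ⟨t, ht, hte⟩ hes
  obtain ⟨hmem, hint⟩ := he
  set p := u (s₁ + e) - u s₁ with hpdef
  have hseg := dist_sq_le_energy hφ hG (x := fun τ => c τ + (p + τ • (q e - p)))
    (x' := fun τ => derivWithin c (Icc 0 1) τ + (q e - p)) (fun τ hτ => by
      have h1 : HasDerivWithinAt (fun τ : ℝ => p + τ • (q e - p)) (q e - p) (Icc 0 1) τ := by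
        simpa using ((hasDerivWithinAt_id τ (Icc (0 : ℝ) 1)).smul_const (q e - p)).const_add p
      exact (hc.hasDeriv τ hτ).fun_add h1) (hc.continuousOn.add continuousOn_const) hmem
  have hx0 : c 0 + (p + (0 : ℝ) • (q e - p)) = u (s₁ + e) := by
    rw [zero_smul, add_zero, hc0, hpdef, add_sub_cancel]
  have hx1 : c 1 + (p + (1 : ℝ) • (q e - p)) = v t₁ + q e := by
    rw [one_smul, add_sub_cancel, hc1]
  have hle : distToCurve β b (α (s₁ + e)) ≤ dist (φ.symm (u (s₁ + e))) (φ.symm (v t₁ + q e)) := by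
    have h1 : φ.symm (u (s₁ + e)) = α (s₁ + e) :=
      φ.left_inv (hαφ _ ⟨by linarith [hs₁.1, hes.1], by linarith [hes.2]⟩)
    rw [hte, h1]
    exact distToCurve_le_dist ht
  rw [← hx0, ← hx1] at hle
  rw [← hdist]
  calc distToCurve β b (α (s₁ + e)) ^ 2 ≤ _ := pow_le_pow_left₀ Metric.infDist_nonneg hle 2
    _ ≤ _ := hseg
    _ ≤ _ := hint

/-- The squared distance to `β` along `α` grows at most cubically. -/
lemma distToCurve_sq_le (hC : 0 < C) (hα : IsUnitSpeedCurve (m := m) α a δ₁)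
    (hβ : IsUnitSpeedCurve (m := m) β b δ₂)
    (hvel : (⟨α 0, velocity α (Icc 0 a) 0⟩ : TangentBundle (𝓡 m) M) =
      ⟨β 0, velocity β (Icc 0 b) 0⟩)
    (hφ : φ ∈ IsManifold.maximalAtlas (𝓡 m) ∞ M) (h : ChartBounds φ C μ)
    (hδ₁ : 0 ≤ δ₁) (hδ₂ : 0 ≤ δ₂) (hs : 0 < s) (hsa : s ≤ a) (hsb : s ≤ b)
    (hsmall : 2 * (flatnessConst m C * |μ|) * max C 1 * s * max C 1 ^ 2 ≤ 1)
    (hmin : ∀ s₁ ∈ Icc 0 s, ∃ t₁ ∈ Icc 0 b, t₁ ≤ 2 * s ∧ (∀ t ∈ Icc 0 t₁, β t ∈ φ.source) ∧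
      dist (α s₁) (β t₁) = distToCurve β b (α s₁) ∧
      ∃ γ : ℝ → M, IsMinimalGeodesic (m := m) γ (α s₁) (β t₁) ∧
        ∀ τ ∈ Icc (0 : ℝ) 1, γ τ ∈ φ.source) :
    distToCurve β b (α s) ^ 2 ≤
      (12 * δ₁ + 16 * δ₂ + 32 * max C 1 ^ 3 * (flatnessConst m C * |μ|)) * s ^ 3 := by
  set D := (12 * δ₁ + 16 * δ₂ + 32 * max C 1 ^ 3 * (flatnessConst m C * |μ|)) * s ^ 2 with hD
  have hαφ : ∀ t ∈ Icc 0 s, α t ∈ φ.source := by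
    intro t ht
    obtain ⟨t₁, -, -, -, -, γ, hγ, hγφ⟩ := hmin t ht
    rw [← hγ.source]
    exact hγφ 0 (left_mem_Icc.2 zero_le_one)
  have hcont : ContinuousOn (fun x => distToCurve β b (α x) ^ 2) (Icc 0 s) :=
    ((Metric.continuous_infDist_pt _).comp_continuousOn
      (hα.contMDiffOn.continuousOn.mono (Icc_subset_Icc_right hsa))).pow 2
  have h0 : distToCurve β b (α 0) ^ 2 ≤ D * 0 := by
    have h0αβ : α 0 = β 0 := congrArg (fun X : TangentBundle (𝓡 m) M => X.1) hvel
    have : distToCurve β b (α 0) = 0 :=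
      Metric.infDist_zero_of_mem ⟨0, left_mem_Icc.2 (hs.le.trans hsb), h0αβ.symm⟩
    simp [this]
  have key := image_le_of_liminf_slope_right_le_deriv_boundary hcont (B := fun x => D * x)
    (B' := fun _ => D) h0 (by fun_prop)
    (fun x _ => by simpa using (hasDerivWithinAt_id x (Ici x)).const_mul D)
    (fun x hx ρ hρ => ?_) (right_mem_Icc.2 hs.le)
  · refine key.trans (le_of_eq ?_)
    rw [hD]
    ring
  obtain ⟨K, hK1, hK2⟩ := exists_between hρ
  obtain ⟨t₁, ht₁, ht₁s, hβφ, hdist, γ, hγ, hγφ⟩ := hmin x (Ico_subset_Icc_self hx)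
  have hev := eventually_distToCurve_sq_le hC hα hβ hvel hφ h hδ₁ hδ₂ hs hsa hsb hαφ hsmall hx ht₁
    ht₁s hβφ hdist hγ hγφ hK1
  have hshift : Tendsto (fun z : ℝ => z - x) (𝓝[>] x) (𝓝[>] 0) := by
    refine tendsto_nhdsWithin_iff.2 ⟨?_, ?_⟩
    · have : Tendsto (fun z : ℝ => z - x) (𝓝 x) (𝓝 (x - x)) := tendsto_id.sub_const x
      rw [sub_self] at this
      exact this.mono_left nhdsWithin_le_nhds
    · filter_upwards [self_mem_nhdsWithin] with z hz using sub_pos.2 (mem_Ioi.1 hz)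
  refine Eventually.frequently ?_
  filter_upwards [hshift.eventually hev, self_mem_nhdsWithin] with z hz hxz
  have hzx : 0 < z - x := sub_pos.2 (mem_Ioi.1 hxz)
  rw [add_sub_cancel] at hz
  rw [slope_def_field, div_lt_iff₀ hzx]
  nlinarith

end Deviation

/-- A distance `r ≤ s` whose square is at most `(A + B) s³` splits into powers of `s`. -/
lemma le_rpow_add_rpow {r s A B : ℝ} (hs : 0 ≤ s) (hA : 0 ≤ A) (hB : 0 ≤ B) (hrs : r ≤ s)
    (h : r ^ 2 ≤ (A + B) * s ^ 3 ∨ 1 ≤ B * s) :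
    r ≤ A ^ (1 / 4 : ℝ) * s ^ (5 / 4 : ℝ) + Real.sqrt B * s ^ (3 / 2 : ℝ) := by
  set x := s ^ (1 / 4 : ℝ) with hx
  set p := A ^ (1 / 4 : ℝ) with hp
  set q := Real.sqrt B with hq
  have hx0 : 0 ≤ x := Real.rpow_nonneg hs _
  have hp0 : 0 ≤ p := Real.rpow_nonneg hA _
  have hq0 : 0 ≤ q := Real.sqrt_nonneg _
  have hsx : s = x ^ 4 := by
    rw [hx, ← Real.rpow_natCast, ← Real.rpow_mul hs]
    norm_num
  have hs5 : s ^ (5 / 4 : ℝ) = x ^ 5 := by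
    rw [hx, ← Real.rpow_natCast, ← Real.rpow_mul hs]
    norm_num
  have hs6 : s ^ (3 / 2 : ℝ) = x ^ 6 := by
    rw [hx, ← Real.rpow_natCast, ← Real.rpow_mul hs]
    norm_num
  have hAp : A = p ^ 4 := by
    rw [hp, ← Real.rpow_natCast, ← Real.rpow_mul hA]
    norm_num
  have hBq : B = q ^ 2 := (Real.sq_sqrt hB).symm
  rw [hs5, hs6]
  rw [hsx] at hrs h
  rw [hAp, hBq] at h
  have hpx : 0 ≤ p * x ^ 5 := by positivity
  have hqx : 0 ≤ q * x ^ 6 := by positivity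
  rcases h with h | h
  · rcases le_total 1 (p * x) with h1 | h1
    · have : x ^ 4 * 1 ≤ x ^ 4 * (p * x) := by gcongr
      nlinarith
    · refine le_of_sq_le_sq ?_ (by positivity)
      have h2 : (p * x) ^ 2 ≤ 1 := pow_le_one₀ (by positivity) h1
      have h3 : (p * x) ^ 2 * (p ^ 2 * x ^ 10) ≤ 1 * (p ^ 2 * x ^ 10) := by gcongr
      nlinarith [mul_nonneg hpx hqx]
  · have h1 : 1 ≤ q * x ^ 2 := by
      by_contra! h2
      have : (q * x ^ 2) ^ 2 < 1 := pow_lt_one₀ (by positivity) h2 two_ne_zero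
      nlinarith
    have : x ^ 4 * 1 ≤ x ^ 4 * (q * x ^ 2) := by gcongr
    nlinarith

end CurveDeviation

end

theorem proposition5p1 :
    ∃ (κ₁ : ℝ → ℝ) (κ₂ : ℕ → ℝ → ℝ → ℝ → ℝ),
      (∀ δ : ℝ, 0 < δ → 0 < κ₁ δ) ∧
      Tendsto κ₁ (𝓝[≥] 0) (𝓝 0) ∧
      (∀ (m : ℕ) (C : ℝ), 0 < C →
        (∀ δ μ : ℝ, 0 < δ → 0 < μ → 0 < κ₂ m C δ μ) ∧
        Tendsto (fun q : ℝ × ℝ => κ₂ m C q.1 q.2)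
          (𝓝[Ici (0 : ℝ) ×ˢ Ici (0 : ℝ)] ((0 : ℝ), (0 : ℝ))) (𝓝 0)) ∧
      ∀ (m : ℕ) (M : Type*) [MetricSpace M] [ChartedSpace (CurveDeviation.Model m) M]
        [IsManifold (𝓡 m) ∞ M]
        [RiemannianBundle (fun x : M => TangentSpace (𝓡 m) x)]
        [IsContMDiffRiemannianBundle (𝓡 m) ∞ (CurveDeviation.Model m)
          (fun x : M => TangentSpace (𝓡 m) x)]
        [IsRiemannianManifold (𝓡 m) M] [CompleteSpace M]
        (C μ δ₁ δ₂ a b s : ℝ) (α β : ℝ → M)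
        (φ : OpenPartialHomeomorph M (CurveDeviation.Model m)),
        0 < C →
        CurveDeviation.IsUnitSpeedCurve (m := m) α a δ₁ →
        CurveDeviation.IsUnitSpeedCurve (m := m) β b δ₂ →
        -- `α(0) = β(0)` and `α'(0) = β'(0)`, as an equality in the tangent bundle
        (⟨α 0, CurveDeviation.velocity α (Icc 0 a) 0⟩ : TangentBundle (𝓡 m) M) =
          ⟨β 0, CurveDeviation.velocity β (Icc 0 b) 0⟩ →
        -- a smooth chart with domain `U = φ.source` around `α(0)`
        φ ∈ IsManifold.maximalAtlas (𝓡 m) ∞ M →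
        α 0 ∈ φ.source →
        CurveDeviation.ChartBounds φ C μ →
        0 ≤ s → s ≤ a → s ≤ b →
        -- up to time `s` the distance to `β` is realized by minimal geodesics inside `U`
        (∀ s₁ ∈ Icc 0 s, ∃ t₁ ∈ Icc 0 b, t₁ ≤ 2 * s ∧
          (∀ t ∈ Icc 0 t₁, β t ∈ φ.source) ∧
          dist (α s₁) (β t₁) = CurveDeviation.distToCurve β b (α s₁) ∧
          ∃ γ : ℝ → M, CurveDeviation.IsMinimalGeodesic (m := m) γ (α s₁) (β t₁) ∧
            ∀ τ ∈ Icc (0 : ℝ) 1, γ τ ∈ φ.source) →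
        CurveDeviation.distToCurve β b (α s) ≤
          κ₁ δ₂ * s ^ (5 / 4 : ℝ) + κ₂ m C δ₁ μ * s ^ (3 / 2 : ℝ) := by
  refine ⟨fun δ => (16 * |δ|) ^ (1 / 4 : ℝ), fun m C δ μ => Real.sqrt (12 * |δ| +
    32 * max C 1 ^ 3 * (CurveDeviation.flatnessConst m C * |μ|)), fun δ hδ => by positivity,
    ?_, fun m C hC => ⟨fun δ μ hδ hμ => ?_, ?_⟩, ?_⟩
  · have : ContinuousAt (fun δ : ℝ => (16 * |δ|) ^ (1 / 4 : ℝ)) 0 :=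
      ContinuousAt.rpow_const (by fun_prop) (Or.inr (by norm_num))
    have h := this.tendsto.mono_left (nhdsWithin_le_nhds (s := Ici 0))
    simpa using h
  · have : 0 ≤ CurveDeviation.flatnessConst m C := by
      unfold CurveDeviation.flatnessConst
      positivity
    positivity
  · have : Continuous (fun q : ℝ × ℝ => Real.sqrt (12 * |q.1| +
        32 * max C 1 ^ 3 * (CurveDeviation.flatnessConst m C * |q.2|))) := by fun_prop
    have h := (this.tendsto ((0 : ℝ), (0 : ℝ))).mono_left
      (nhdsWithin_le_nhds (s := Ici (0 : ℝ) ×ˢ Ici (0 : ℝ)))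
    simpa using h
  · intro m M _ _ _ _ _ _ _ C μ δ₁ δ₂ a b s α β φ hC hα hβ hvel hφ hα0 h hs hsa hsb hmin
    have h0αβ : α 0 = β 0 := congrArg (fun X : TangentBundle (𝓡 m) M => X.1) hvel
    have hδ₁ : 0 ≤ δ₁ := (norm_nonneg _).trans
      (hα.curvature_le 0 (left_mem_Icc.2 (hs.trans hsa)) φ hφ hα0)
    have hδ₂ : 0 ≤ δ₂ := (norm_nonneg _).trans
      (hβ.curvature_le 0 (left_mem_Icc.2 (hs.trans hsb)) φ hφ (h0αβ ▸ hα0))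
    have hrs : CurveDeviation.distToCurve β b (α s) ≤ s := by
      refine (CurveDeviation.distToCurve_le_dist (left_mem_Icc.2 (hs.trans hsb))).trans ?_
      rw [← h0αβ, dist_comm]
      exact hα.dist_le ⟨hs, hsa⟩
    have hκ : 0 ≤ CurveDeviation.flatnessConst m C * |μ| := by
      unfold CurveDeviation.flatnessConst
      positivity
    simp only [abs_of_nonneg hδ₁, abs_of_nonneg hδ₂]
    refine CurveDeviation.le_rpow_add_rpow hs (by positivity) (by positivity) hrs ?_
    rcases hs.eq_or_lt with rfl | hs'
    · left
      have : CurveDeviation.distToCurve β b (α 0) = 0 := le_antisymm hrs Metric.infDist_nonneg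
      simp [this]
    rcases le_total (2 * (CurveDeviation.flatnessConst m C * |μ|) * max C 1 * s * max C 1 ^ 2) 1
      with hsmall | hlarge
    · left
      refine (CurveDeviation.distToCurve_sq_le hC hα hβ hvel hφ h hδ₁ hδ₂ hs' hsa hsb hsmall
        hmin).trans (le_of_eq ?_)
      ring
    · -- for large `s`, the bound of the distance by the length of `α` is good enough
      right
      have h1 : 0 ≤ max C 1 ^ 3 * (CurveDeviation.flatnessConst m C * |μ|) * s := by positivity
      have h2 : 0 ≤ δ₁ * s := by positivity
      nlinarith
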